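/- Let $n\ge 2$, $\lambda=\frac{n-1}{2}$, and let $\mathcal S^n\subset\mathbb R^{n+1}$ be the unit sphere with surface measure $\sigma$ and Laplace--Beltrami operator $\Delta^\ast$. For a real function $f\in C^2(\mathcal S^n)$ with $\int_{\mathcal S^n}x\,|f(x)|^2\,d\sigma(x)\neq 0$ put $$ \mathrm{var}_S(f)=\left(\frac{\int_{\mathcal S^n}|f|^2\,d\sigma}{\left\|\int_{\mathcal S^n}x\,|f(x)|^2\,d\sigma(x)\right\|}\right)^2-1,\qquad \mathrm{var}_M(f)=-\frac{\int_{\mathcal S^n}\Delta^\ast f\cdot f\,d\sigma}{\int_{\mathcal S^n}|f|^2\,d\sigma},\qquad U(f)=\sqrt{\mathrm{var}_S(f)}\cdot\sqrt{\mathrm{var}_M(f)}. $$ Let $C_l^\lambda$ be the Gegenbauer polynomials, given by $\sum_{l\ge0}C_l^\lambda(t)\,r^l=(1-2tr+r^2)^{-\lambda}$. Let $a>0$, $c>0$, and let $q_\nu$ be a real polynomial of degree $\nu\ge1$ such that $q_\nu(l)>0$ for all integers $l\geq1$ and $q_\nu(l)\le q_\nu(m)$ for all integers $m\ge l\ge1$.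 For $\rho>0$ let $$ \Psi_\rho(x)=\sum_{l=0}^\infty\left[\rho^a q_\nu(l)\right]^c e^{-\rho^a q_\nu(l)}\,\frac{l+\lambda}{\lambda}\,C_l^\lambda(x_1),\qquad x=(x_1,\dots,x_{n+1})\in\mathcal S^n. $$ (If $q_\nu(0)<0$, the power in the term $l=0$ is read as the real part of its principal value, $y^c:=|y|^c\cos(\pi c)$ for $y<0$; this is the usual power when $c$ is an integer.) Then for every $\rho>0$ the series converges absolutely at every point of $\mathcal S^n$ and $\Psi_\rho\in C^2(\mathcal S^n)$; for all sufficiently small $\rho>0$, $\int_{\mathcal S^n}x\,|\Psi_\rho(x)|^2\,d\sigma(x)\ne0$; and, as $\rho\to0^+$, $$ \mathrm{var}_S(\Psi_\rho)=\mathcal O\!\left(\rho^{a/\nu}\right),\qquad \mathrm{var}_M(\Psi_\rho)=\mathcal O\!\left(\rho^{-2a/\nu}\right),\qquad U(\Psi_\rho)=\mathcal O\!\left(\rho^{-a/(2\nu)}\right). $$ -/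

import Mathlib

open MeasureTheory Filter Topology Asymptotics
open scoped Manifold ContDiff

noncomputable section

namespace SphericalWavelet

/-- The ambient Euclidean space `ℝ^{n+1}`. -/
abbrev Ambient (n : ℕ) : Type := EuclideanSpace ℝ (Fin (n + 1))

/-- The unit sphere `𝒮^n ⊆ ℝ^{n+1}`. -/
abbrev Sph (n : ℕ) : Type := Metric.sphere (0 : Ambient n) 1

/-- The (unnormalized) surface measure `σ` on `𝒮^n`. -/
def surf (n : ℕ) : Measure (Sph n) := (volume : Measure (Ambient n)).toSphere

/-- The extension of a function on `𝒮^n` to `ℝ^{n+1} ∖ {0}` that is constant along rays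
(with the irrelevant value `0` at the origin). -/
def radialExt {n : ℕ} (f : Sph n → ℝ) (y : Ambient n) : ℝ :=
  open Classical in
  if hy : y ≠ 0 then
    f ⟨‖y‖⁻¹ • y, by
      rw [mem_sphere_zero_iff_norm, norm_smul, norm_inv, norm_norm,
        inv_mul_cancel₀ (norm_ne_zero_iff.mpr hy)]⟩
  else 0

/-- The Laplace–Beltrami operator `Δ*` on `𝒮^n`: the Euclidean Laplacian of the extension that is
constant along rays, evaluated on the sphere. -/
def laplaceBeltrami {n : ℕ} (f : Sph n → ℝ) (x : Sph n) : ℝ :=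
  Laplacian.laplacian (radialExt f) (x : Ambient n)

/-- The vector `∫ x |f(x)|² dσ(x) ∈ ℝ^{n+1}`. -/
def firstMoment {n : ℕ} (f : Sph n → ℝ) : Ambient n :=
  ∫ x, |f x| ^ 2 • (x : Ambient n) ∂(surf n)

/-- The variance in space domain; the square of a vector is the square of its Euclidean norm. -/
def varS {n : ℕ} (f : Sph n → ℝ) : ℝ :=
  ((∫ x, |f x| ^ 2 ∂(surf n)) / ‖firstMoment f‖) ^ 2 - 1

/-- The variance in momentum domain. -/
def varM {n : ℕ} (f : Sph n → ℝ) : ℝ :=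
  -((∫ x, laplaceBeltrami f x * f x ∂(surf n)) / ∫ x, |f x| ^ 2 ∂(surf n))

/-- The uncertainty product. -/
def uncertaintyProduct {n : ℕ} (f : Sph n → ℝ) : ℝ :=
  √(varS f) * √(varM f)

/-- The Gegenbauer polynomial `C_l^lam`, evaluated at `t`: the coefficient of `r^l` in the power
series of the generating function `r ↦ (1 - 2tr + r²)^{-lam}` at `r = 0`. -/
def gegenbauer (lam : ℝ) (l : ℕ) (t : ℝ) : ℝ :=
  iteratedDeriv l (fun r : ℝ => (1 - 2 * t * r + r ^ 2) ^ (-lam)) 0 / (l.factorial : ℝ)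

/-- `λ = (n - 1) / 2`. -/
def order (n : ℕ) : ℝ := ((n : ℝ) - 1) / 2

/-- The Gegenbauer coefficients `[ρ^a q(l)]^c e^{-ρ^a q(l)} (l + λ) / λ`. -/
def waveletCoeff (n : ℕ) (a c : ℝ) (q : Polynomial ℝ) (ρ : ℝ) (l : ℕ) : ℝ :=
  (ρ ^ a * q.eval (l : ℝ)) ^ c * Real.exp (-(ρ ^ a * q.eval (l : ℝ))) *
    (((l : ℝ) + order n) / order n)

/-- The `l`-th term of the Gegenbauer expansion of the wavelet at `x`, where `x 0` is the first
coordinate `cos ϑ` of `x`. -/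
def waveletTerm (n : ℕ) (a c : ℝ) (q : Polynomial ℝ) (ρ : ℝ) (x : Sph n) (l : ℕ) : ℝ :=
  waveletCoeff n a c q ρ l * gegenbauer (order n) l ((x : Ambient n) 0)

/-- The zonal wavelet `Ψ_ρ` on `𝒮^n`. -/
def wavelet (n : ℕ) (a c : ℝ) (q : Polynomial ℝ) (ρ : ℝ) (x : Sph n) : ℝ :=
  ∑' l : ℕ, waveletTerm n a c q ρ x l

end SphericalWavelet

end

/-!
The wavelet is zonal, `Ψ_ρ = ∑ w_l (l + λ) / λ C_l^λ(x₁)`, and orthogonality of the Gegenbauer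
polynomials turns its mass, the first component of its moment and its energy into series in the
`w_l` with weights comparable to `l ^ (n - 1)`; the other components of the moment only help. The
three term recurrence makes the defect mass minus moment equal to half of the sum of
`weight * (w_l - w_{l + 1}) ^ 2`. On the scale `δ = ρ ^ (a / ν)` the `w_l` are samples of
`y ^ c * exp (-y)` at `y ≍ (δ l) ^ ν`, so these series are Riemann sums: the mass is at least of
order `δ ^ {-n}`, the defect at most of order `δ ^ {2 - n}` and the energy at most of order
`δ ^ {-n - 2}`. Hence the variances are `O(δ ^ 2)` and `O(δ ^ {-2})`, which is better than claimed
for the space variance.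

The coefficients decay geometrically, so the series extends holomorphically to a Bernstein ellipse
around `[-1, 1]`; this gives smoothness and allows termwise application of the Laplacian.
-/

noncomputable section

namespace SphericalWavelet

section GegenbauerPolynomials

open Polynomial

/-- The Gegenbauer polynomials `C_l^lam`, encoded by their three-term recurrence;
`gegenbauer_eq_eval_gegenbauerPoly` identifies their values with `gegenbauer`. -/
def gegenbauerPoly (lam : ℝ) : ℕ → ℝ[X]
  | 0 => 1
  | 1 => C (2 * lam) * X
  | l + 2 => C ((l : ℝ) + 2)⁻¹ * (C (2 * ((l : ℝ) + 1 + lam)) * X * gegenbauerPoly lam (l + 1)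
      - C ((l : ℝ) + 2 * lam) * gegenbauerPoly lam l)

theorem gegenbauerPoly_add_two (lam : ℝ) (l : ℕ) :
    C ((l : ℝ) + 2) * gegenbauerPoly lam (l + 2) =
      C (2 * ((l : ℝ) + 1 + lam)) * X * gegenbauerPoly lam (l + 1)
        - C ((l : ℝ) + 2 * lam) * gegenbauerPoly lam l := by
  have hl : (l : ℝ) + 2 ≠ 0 := by positivity
  rw [gegenbauerPoly, ← mul_assoc, ← C_mul, mul_inv_cancel₀ hl, C_1, one_mul]

theorem derivative_gegenbauerPoly_relations (lam : ℝ) (l : ℕ) :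
    X * derivative (gegenbauerPoly lam (l + 1)) - derivative (gegenbauerPoly lam l) =
        C ((l : ℝ) + 1) * gegenbauerPoly lam (l + 1) ∧
      derivative (gegenbauerPoly lam (l + 1)) - X * derivative (gegenbauerPoly lam l) =
        C ((l : ℝ) + 2 * lam) * gegenbauerPoly lam l := by
  induction l with
  | zero => constructor <;> simp [gegenbauerPoly, mul_comm]
  | succ l ih =>
    obtain ⟨hX, hX'⟩ := ih
    have hrec := gegenbauerPoly_add_two lam l
    have hrec' := congrArg derivative hrec
    simp only [derivative_mul, derivative_sub, derivative_C, derivative_X, zero_mul, zero_add,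
      mul_one] at hrec'
    have hl : (C ((l : ℝ) + 2) : ℝ[X]) ≠ 0 := by
      rw [Ne, C_eq_zero]; positivity
    simp only [C_add, C_mul, C_1, map_ofNat, Nat.cast_add, Nat.cast_one] at *
    have hnext : derivative (gegenbauerPoly lam (l + 1 + 1)) -
        X * derivative (gegenbauerPoly lam (l + 1)) =
        (C (l : ℝ) + 1 + 2 * C lam) * gegenbauerPoly lam (l + 1) := by
      refine mul_left_cancel₀ hl ?_
      linear_combination hrec' + (C (l : ℝ) + 2 * C lam) * hX
    refine ⟨?_, hnext⟩
    linear_combination X * hnext - hrec + X * hX - hX'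

theorem gegenbauerPoly_ode (lam : ℝ) (l : ℕ) :
    (1 - X ^ 2) * derivative (derivative (gegenbauerPoly lam l))
        - C (2 * lam + 1) * X * derivative (gegenbauerPoly lam l)
      = - C ((l : ℝ) * (l + 2 * lam)) * gegenbauerPoly lam l := by
  cases l with
  | zero => simp [gegenbauerPoly]
  | succ l =>
    obtain ⟨hX, hX'⟩ := derivative_gegenbauerPoly_relations lam l
    have hfirst : (1 - X ^ 2) * derivative (gegenbauerPoly lam (l + 1)) =
        C ((l : ℝ) + 2 * lam) * gegenbauerPoly lam l
          - C ((l : ℝ) + 1) * X * gegenbauerPoly lam (l + 1) := by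
      linear_combination hX' - X * hX
    have hsecond := congrArg derivative hfirst
    simp only [derivative_mul, derivative_sub, derivative_C, derivative_X, derivative_one,
      derivative_X_pow, zero_mul, zero_add, mul_one] at hsecond
    simp only [C_add, C_mul, C_1, map_ofNat, Nat.cast_add, Nat.cast_one, pow_one,
      Nat.add_one_sub_one, Nat.cast_ofNat] at *
    linear_combination hsecond - (C (l : ℝ) + 2 * C lam) * hX

theorem eval_one_gegenbauerPoly_succ (lam : ℝ) (l : ℕ) :
    ((l : ℝ) + 1) * (gegenbauerPoly lam (l + 1)).eval 1 =
      ((l : ℝ) + 2 * lam) * (gegenbauerPoly lam l).eval 1 := by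
  obtain ⟨hX, hX'⟩ := derivative_gegenbauerPoly_relations lam l
  replace hX := congrArg (eval 1) hX
  replace hX' := congrArg (eval 1) hX'
  simp only [eval_sub, eval_mul, eval_X, eval_C] at hX hX'
  linear_combination hX' - hX

theorem eval_one_gegenbauerPoly_nonneg {lam : ℝ} (hlam : 0 ≤ lam) (l : ℕ) :
    0 ≤ (gegenbauerPoly lam l).eval 1 := by
  induction l with
  | zero => simp [gegenbauerPoly]
  | succ l ih =>
    have h : 0 ≤ ((l : ℝ) + 1) * (gegenbauerPoly lam (l + 1)).eval 1 := by
      rw [eval_one_gegenbauerPoly_succ]; positivity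
    exact nonneg_of_mul_nonneg_right h (by positivity)

theorem eval_one_gegenbauerPoly_le {lam : ℝ} (hlam : 0 ≤ lam) {m : ℕ} (hm : 2 * lam ≤ m + 1)
    (l : ℕ) : (gegenbauerPoly lam l).eval 1 ≤ ((l : ℝ) + 1) ^ m := by
  induction l with
  | zero => simp [gegenbauerPoly]
  | succ l ih =>
    have hl : (0 : ℝ) < (l : ℝ) + 1 := by positivity
    have bernoulli : 1 + (m : ℝ) * (1 / ((l : ℝ) + 1)) ≤ (1 + 1 / ((l : ℝ) + 1)) ^ m :=
      one_add_mul_le_pow ((by norm_num : (-2 : ℝ) ≤ 0).trans (by positivity)) m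
    have hratio : (l : ℝ) + 2 * lam ≤ ((l : ℝ) + 1) * (1 + 1 / ((l : ℝ) + 1)) ^ m := by
      refine le_trans ?_ (mul_le_mul_of_nonneg_left bernoulli hl.le)
      field_simp
      linarith
    refine le_of_mul_le_mul_left ?_ hl
    calc ((l : ℝ) + 1) * (gegenbauerPoly lam (l + 1)).eval 1
        = (l + 2 * lam) * (gegenbauerPoly lam l).eval 1 := eval_one_gegenbauerPoly_succ lam l
      _ ≤ (l + 1) * (1 + 1 / ((l : ℝ) + 1)) ^ m * (l + 1) ^ m :=
        mul_le_mul hratio ih (eval_one_gegenbauerPoly_nonneg hlam l) (by positivity)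
      _ = (l + 1) * ((l + 1 : ℕ) + 1) ^ m := by
        rw [mul_assoc, ← mul_pow]
        congr 2
        push_cast
        field_simp

end GegenbauerPolynomials

section GeneratingFunction

open PowerSeries

theorem coeff_X_mul_derivative {K : Type*} [CommRing K] (E : K⟦X⟧) (k : ℕ) :
    coeff k (X * d⁄dX K E) = k * coeff k E := by
  cases k with
  | zero => simp
  | succ k => rw [coeff_succ_X_mul, coeff_derivative]; push_cast; ring

theorem coeff_add_two_of_gegenbauer_ode {K : Type*} [CommRing K] {lam t : K} {E : K⟦X⟧}
    (hE : (1 - C (2 * t) * X + X ^ 2) * d⁄dX K E = C (2 * lam) * (C t - X) * E) (l : ℕ) :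
    ((l : K) + 2) * coeff (l + 2) E =
      2 * ((l : K) + 1 + lam) * t * coeff (l + 1) E - ((l : K) + 2 * lam) * coeff l E := by
  have hE' : d⁄dX K E - C (2 * t) * (X * d⁄dX K E) + X * (X * d⁄dX K E) =
      C (2 * lam) * (C t * E - X * E) := by
    linear_combination hE
  have h := congrArg (coeff (l + 1)) hE'
  simp only [map_add, map_sub, coeff_C_mul, coeff_succ_X_mul, coeff_X_mul_derivative,
    coeff_derivative] at h
  push_cast at h
  linear_combination h

theorem coeff_eq_aeval_gegenbauerPoly {K : Type*} [Field K] [Algebra ℝ K] (lam : ℝ) (t : K)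
    {E : K⟦X⟧} (h0 : coeff 0 E = 1)
    (hE : (1 - C (2 * t) * X + X ^ 2) * d⁄dX K E
      = C (2 * algebraMap ℝ K lam) * (C t - X) * E) (l : ℕ) :
    coeff l E = Polynomial.aeval t (gegenbauerPoly lam l) := by
  have hK : CharZero K := charZero_of_injective_algebraMap (algebraMap ℝ K).injective
  have h1 : coeff 1 E = 2 * algebraMap ℝ K lam * t := by
    have h := congrArg (coeff 0) hE
    simp only [coeff_zero_eq_constantCoeff, map_mul, map_add, map_sub, map_one, constantCoeff_C,
      constantCoeff_X, mul_zero, sub_zero, map_pow, zero_pow two_ne_zero, add_zero, one_mul] at h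
    rw [← coeff_zero_eq_constantCoeff_apply, coeff_derivative,
      ← coeff_zero_eq_constantCoeff_apply, h0] at h
    simpa using h
  induction l using Nat.strong_induction_on with
  | _ l ih =>
    match l with
    | 0 => simpa [gegenbauerPoly] using h0
    | 1 => simpa [gegenbauerPoly, map_ofNat] using h1
    | l + 2 =>
      have hl : (l : K) + 2 ≠ 0 := by exact_mod_cast (Nat.succ_ne_zero (l + 1))
      have hrec := congrArg (Polynomial.aeval t) (gegenbauerPoly_add_two lam l)
      simp only [map_mul, map_sub, map_add, Polynomial.aeval_C, Polynomial.aeval_X, map_natCast,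
        map_ofNat, map_one] at hrec
      refine mul_left_cancel₀ hl ?_
      rw [coeff_add_two_of_gegenbauer_ode hE, hrec, ih _ (by omega), ih _ (by omega)]

/-- The formal Taylor series at `0` of a real function; it turns the differential equation of the
generating function into an identity of power series. -/
def taylorAtZero (f : ℝ → ℝ) : ℝ⟦X⟧ :=
  PowerSeries.mk fun k => iteratedDeriv k f 0 / (k.factorial : ℝ)

theorem taylorAtZero_mul {f g : ℝ → ℝ} (hf : ContDiffAt ℝ ∞ f 0) (hg : ContDiffAt ℝ ∞ g 0) :
    taylorAtZero (f * g) = taylorAtZero f * taylorAtZero g := by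
  ext k
  rw [coeff_mul, Finset.Nat.sum_antidiagonal_eq_sum_range_succ_mk]
  simp only [taylorAtZero, coeff_mk]
  rw [iteratedDeriv_mul (hf.of_le (by exact_mod_cast le_top)) (hg.of_le (by exact_mod_cast le_top)),
    Finset.sum_div]
  refine Finset.sum_congr rfl fun i hi => ?_
  rw [Nat.cast_choose ℝ (Finset.mem_range_succ_iff.mp hi)]
  have := Nat.factorial_ne_zero k
  field_simp

theorem taylorAtZero_deriv (f : ℝ → ℝ) : taylorAtZero (deriv f) = d⁄dX ℝ (taylorAtZero f) := by
  ext k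
  rw [coeff_derivative]
  simp only [taylorAtZero, coeff_mk, iteratedDeriv_succ', Nat.factorial_succ]
  push_cast
  field_simp

theorem taylorAtZero_congr {f g : ℝ → ℝ} (h : f =ᶠ[𝓝 0] g) :
    taylorAtZero f = taylorAtZero g := by
  ext k
  simp only [taylorAtZero, coeff_mk, h.iteratedDeriv_eq]

theorem iteratedDeriv_polynomial_eval (p : Polynomial ℝ) (k : ℕ) :
    iteratedDeriv k (fun r => p.eval r) = fun r => (Polynomial.derivative^[k] p).eval r := by
  induction k with
  | zero => simp
  | succ k ih =>
    funext r
    rw [iteratedDeriv_succ, ih, Polynomial.deriv, Function.iterate_succ_apply']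

theorem taylorAtZero_polynomial_eval (p : Polynomial ℝ) :
    taylorAtZero (fun r => p.eval r) = p := by
  ext k
  have hk : (k.factorial : ℝ) ≠ 0 := by positivity
  rw [taylorAtZero, coeff_mk, iteratedDeriv_polynomial_eval]
  simp only [← Polynomial.coeff_zero_eq_eval_zero]
  rw [Polynomial.coeff_iterate_derivative, zero_add, Nat.descFactorial_self, nsmul_eq_mul,
    mul_div_cancel_left₀ _ hk, Polynomial.coeff_coe]

theorem quadratic_mul_deriv_generatingFunction (lam t : ℝ) {r : ℝ}
    (hr : 0 < 1 - 2 * t * r + r ^ 2) :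
    (1 - 2 * t * r + r ^ 2) * deriv (fun s : ℝ => (1 - 2 * t * s + s ^ 2) ^ (-lam)) r =
      2 * lam * (t - r) * (1 - 2 * t * r + r ^ 2) ^ (-lam) := by
  have hquad : HasDerivAt (fun s : ℝ => 1 - 2 * t * s + s ^ 2) (-(2 * t) + 2 * r) r := by
    simpa using
      (((hasDerivAt_id' r).const_mul (2 * t)).const_sub 1).fun_add ((hasDerivAt_id' r).fun_pow 2)
  rw [(hquad.rpow_const (p := -lam) (Or.inl hr.ne')).deriv, Real.rpow_sub_one hr.ne']
  field_simp
  ring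

theorem gegenbauer_eq_eval_gegenbauerPoly (lam : ℝ) (l : ℕ) (t : ℝ) :
    gegenbauer lam l t = (gegenbauerPoly lam l).eval t := by
  set G : ℝ → ℝ := fun r => (1 - 2 * t * r + r ^ 2) ^ (-lam) with hG
  have hGsmooth : ContDiffAt ℝ ∞ G 0 :=
    ContDiffAt.rpow_const_of_ne (by fun_prop) (by simp)
  have hG'smooth : ContDiffAt ℝ ∞ (deriv G) 0 :=
    (hGsmooth.fderiv_right (m := ∞) (by simp)).clm_apply contDiffAt_const
  have hpoly (p : Polynomial ℝ) : ContDiffAt ℝ ∞ (fun r => p.eval r) 0 := by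
    simpa only [Polynomial.coe_aeval_eq_eval] using (p.contDiff_aeval (𝕜 := ℝ) ∞).contDiffAt
  have hode : (fun r => (1 - .C (2 * t) * .X + .X ^ 2 : Polynomial ℝ).eval r) * deriv G =ᶠ[𝓝 0]
      (fun r => (.C (2 * lam) * (.C t - .X) : Polynomial ℝ).eval r) * G := by
    have hpos : ∀ᶠ r : ℝ in 𝓝 0, 0 < 1 - 2 * t * r + r ^ 2 :=
      (by fun_prop : ContinuousAt (fun r : ℝ => 1 - 2 * t * r + r ^ 2) 0).eventually
        (lt_mem_nhds (by simp))
    filter_upwards [hpos] with r hr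
    simpa using quadratic_mul_deriv_generatingFunction lam t hr
  have hseries := taylorAtZero_congr hode
  rw [taylorAtZero_mul (hpoly _) hG'smooth, taylorAtZero_mul (hpoly _) hGsmooth, taylorAtZero_deriv,
    taylorAtZero_polynomial_eval, taylorAtZero_polynomial_eval] at hseries
  have hcoeff := coeff_eq_aeval_gegenbauerPoly lam t (E := taylorAtZero G)
    (by simp [taylorAtZero, hG]) (by simpa using hseries) l
  simpa [taylorAtZero, gegenbauer, Polynomial.aeval_def] using hcoeff

end GeneratingFunction

section BernsteinEllipse

open PowerSeries

theorem multichoose_succ (lam : ℝ) (j : ℕ) :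
    ((j : ℝ) + 1) * Ring.multichoose lam (j + 1) = (lam + j) * Ring.multichoose lam j := by
  have hj := Ring.factorial_nsmul_multichoose_eq_ascPochhammer lam j
  have hj' := Ring.factorial_nsmul_multichoose_eq_ascPochhammer lam (j + 1)
  rw [Polynomial.ascPochhammer_smeval_eq_eval, nsmul_eq_mul] at hj hj'
  rw [ascPochhammer_succ_eval, ← hj, Nat.factorial_succ] at hj'
  push_cast at hj'
  have hfact : (j.factorial : ℝ) ≠ 0 := by positivity
  refine mul_left_cancel₀ hfact ?_
  linear_combination hj'

theorem multichoose_nonneg {lam : ℝ} (hlam : 0 ≤ lam) (j : ℕ) : 0 ≤ Ring.multichoose lam j := by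
  induction j with
  | zero => simp
  | succ j ih =>
    have h : 0 ≤ ((j : ℝ) + 1) * Ring.multichoose lam (j + 1) := by
      rw [multichoose_succ]; positivity
    exact nonneg_of_mul_nonneg_right h (by positivity)

/-- The power series `(1 - yX)^{-lam}`. -/
def negBinomialSeries {K : Type*} [Field K] [Algebra ℝ K] (lam : ℝ) (y : K) : K⟦X⟧ :=
  PowerSeries.mk fun j => algebraMap ℝ K (Ring.multichoose lam j) * y ^ j

theorem negBinomialSeries_ode {K : Type*} [Field K] [Algebra ℝ K] (lam : ℝ) (y : K) :
    (1 - C y * X) * d⁄dX K (negBinomialSeries lam y) =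
      C (algebraMap ℝ K lam * y) * negBinomialSeries lam y := by
  ext k
  have hk := congrArg (algebraMap ℝ K) (multichoose_succ lam k)
  simp only [map_mul, map_add, map_natCast, map_one] at hk
  rw [sub_mul, one_mul, mul_assoc, map_sub, coeff_C_mul, coeff_X_mul_derivative, coeff_derivative,
    coeff_C_mul]
  simp only [negBinomialSeries, coeff_mk]
  linear_combination y ^ (k + 1) * hk

theorem aeval_gegenbauerPoly_joukowski {K : Type*} [Field K] [Algebra ℝ K] (lam : ℝ) {z : K}
    (hz : z ≠ 0) (l : ℕ) :
    Polynomial.aeval ((z + z⁻¹) / 2) (gegenbauerPoly lam l) =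
      coeff l (negBinomialSeries lam z * negBinomialSeries lam z⁻¹) := by
  have hK : CharZero K := charZero_of_injective_algebraMap (algebraMap ℝ K).injective
  symm
  apply coeff_eq_aeval_gegenbauerPoly
  · simp [negBinomialSeries]
  · have hzz : (C z : K⟦X⟧) * C z⁻¹ = 1 := by rw [← map_mul, mul_inv_cancel₀ hz, map_one]
    have hsum : (2 : K⟦X⟧) * C ((z + z⁻¹) / 2) = C z + C z⁻¹ := by
      rw [← map_ofNat (C (R := K)), ← map_mul, ← map_add]; congr 1; field_simp
    have e₁ := negBinomialSeries_ode lam z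
    have e₂ := negBinomialSeries_ode lam z⁻¹
    simp only [Derivation.leibniz, smul_eq_mul, map_mul, map_ofNat] at e₁ e₂ ⊢
    set A := negBinomialSeries lam z
    set B := negBinomialSeries lam z⁻¹
    linear_combination (1 - C z⁻¹ * X) * B * e₁ + (1 - C z * X) * A * e₂
      - (X ^ 2 * (A * d⁄dX K B + B * d⁄dX K A)
        + 2 * C (algebraMap ℝ K lam) * X * A * B) * hzz
      - (X * (A * d⁄dX K B + B * d⁄dX K A) + C (algebraMap ℝ K lam) * A * B) * hsum

/-- The open ellipse with foci `±1` and semi-axes `(R ± R⁻¹) / 2`: the image of the annulus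
`R⁻¹ < ‖z‖ < R` under the Joukowski map `z ↦ (z + z⁻¹) / 2`. -/
def bernsteinEllipse (R : ℝ) : Set ℂ := {t | ‖t - 1‖ + ‖t + 1‖ < R + R⁻¹}

theorem isOpen_bernsteinEllipse (R : ℝ) : IsOpen (bernsteinEllipse R) :=
  isOpen_lt (by fun_prop) continuous_const

theorem ofReal_mem_bernsteinEllipse {R t : ℝ} (hR : 1 < R) (ht : |t| ≤ 1) :
    (t : ℂ) ∈ bernsteinEllipse R := by
  obtain ⟨ht₁, ht₂⟩ := abs_le.mp ht
  have hfoci : ‖(t : ℂ) - 1‖ + ‖(t : ℂ) + 1‖ = 2 := by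
    rw [← Complex.ofReal_one, ← Complex.ofReal_sub, ← Complex.ofReal_add, Complex.norm_real,
      Complex.norm_real, Real.norm_of_nonpos (by linarith), Real.norm_of_nonneg (by linarith)]
    ring
  have hpos : 0 < (R - 1) ^ 2 / R := div_pos (pow_pos (by linarith) 2) (by linarith)
  have hR' : (R - 1) ^ 2 / R = R + R⁻¹ - 2 := by field_simp; ring
  rw [bernsteinEllipse, Set.mem_ofPred_eq, hfoci]
  linarith

theorem norm_joukowski_sub_one_add_norm_joukowski_add_one {z : ℂ} (hz : z ≠ 0) :
    ‖(z + z⁻¹) / 2 - 1‖ + ‖(z + z⁻¹) / 2 + 1‖ = ‖z‖ + ‖z‖⁻¹ := by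
  have : 0 < ‖z‖ := norm_pos_iff.mpr hz
  have hsub : (z + z⁻¹) / 2 - 1 = (z - 1) ^ 2 / (2 * z) := by field_simp; ring
  have hadd : (z + z⁻¹) / 2 + 1 = (z + 1) ^ 2 / (2 * z) := by field_simp; ring
  have hpar := parallelogram_law_with_norm ℝ z 1
  rw [norm_one] at hpar
  rw [hsub, hadd]
  simp only [norm_div, norm_pow, norm_mul, Complex.norm_ofNat]
  field_simp
  linarith

theorem exists_joukowski_eq (t : ℂ) : ∃ z : ℂ, z ≠ 0 ∧ (z + z⁻¹) / 2 = t := by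
  obtain ⟨s, hs⟩ := IsAlgClosed.exists_pow_nat_eq (t ^ 2 - 1) (n := 2) (by norm_num)
  have hprod : (t + s) * (t - s) = 1 := by linear_combination -hs
  refine ⟨t + s, left_ne_zero_of_mul_eq_one hprod, ?_⟩
  rw [inv_eq_of_mul_eq_one_right hprod]
  ring

theorem exists_joukowski_of_mem_bernsteinEllipse {R : ℝ} (hR : 1 < R) {t : ℂ}
    (ht : t ∈ bernsteinEllipse R) :
    ∃ z : ℂ, z ≠ 0 ∧ (z + z⁻¹) / 2 = t ∧ ‖z‖ ≤ R ∧ ‖z⁻¹‖ ≤ R := by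
  obtain ⟨z, hz, rfl⟩ := exists_joukowski_eq t
  refine ⟨z, hz, rfl, ?_⟩
  have hnorm : 0 < ‖z‖ := norm_pos_iff.mpr hz
  rw [bernsteinEllipse, Set.mem_ofPred_eq,
    norm_joukowski_sub_one_add_norm_joukowski_add_one hz] at ht
  have hbetween : (‖z‖ - R) * (‖z‖ - R⁻¹) < 0 := by
    have hfactor : (‖z‖ - R) * (‖z‖ - R⁻¹) = ‖z‖ * ((‖z‖ + ‖z‖⁻¹) - (R + R⁻¹)) := by
      field_simp
      ring
    rw [hfactor]
    exact mul_neg_of_pos_of_neg hnorm (by linarith)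
  have hRinv : R⁻¹ < R := (inv_lt_one_of_one_lt₀ hR).trans hR
  rcases mul_neg_iff.mp hbetween with ⟨hgt, hlt⟩ | ⟨hlt, hgt⟩
  · linarith
  · refine ⟨by linarith, ?_⟩
    rw [norm_inv]
    exact inv_le_of_inv_le₀ (by linarith) (by linarith)

theorem norm_coeff_negBinomialSeries_le {lam R : ℝ} (hlam : 0 ≤ lam) {z : ℂ} (hz : ‖z‖ ≤ R)
    (j : ℕ) :
    ‖coeff j (negBinomialSeries lam z)‖ ≤ R ^ j * coeff j (negBinomialSeries lam (1 : ℝ)) := by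
  have hj := multichoose_nonneg hlam j
  simp only [negBinomialSeries, coeff_mk, norm_mul, norm_pow, Complex.coe_algebraMap,
    Complex.norm_real, Real.norm_of_nonneg hj, Algebra.algebraMap_self, RingHom.id_apply, one_pow,
    mul_one]
  rw [mul_comm (R ^ j)]
  gcongr

/-- With `t = (z + z⁻¹) / 2`, the generating function factors as
`(1 - zX)^{-lam} (1 - z⁻¹X)^{-lam}`, whose coefficients are largest at `z = 1`. -/
theorem norm_aeval_gegenbauerPoly_le {lam R : ℝ} (hlam : 0 ≤ lam) (hR : 1 < R) {t : ℂ}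
    (ht : t ∈ bernsteinEllipse R) (l : ℕ) :
    ‖Polynomial.aeval t (gegenbauerPoly lam l)‖ ≤ R ^ l * (gegenbauerPoly lam l).eval 1 := by
  obtain ⟨z, hz, rfl, hzR, hzR'⟩ := exists_joukowski_of_mem_bernsteinEllipse hR ht
  have hone := aeval_gegenbauerPoly_joukowski lam (one_ne_zero : (1 : ℝ) ≠ 0) l
  rw [inv_one, add_self_div_two, Polynomial.coe_aeval_eq_eval] at hone
  rw [aeval_gegenbauerPoly_joukowski lam hz, hone, coeff_mul, coeff_mul, Finset.mul_sum]
  refine (norm_sum_le _ _).trans (Finset.sum_le_sum fun p hp => ?_)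
  rw [← Finset.HasAntidiagonal.mem_antidiagonal.mp hp, norm_mul, pow_add, mul_mul_mul_comm]
  gcongr
  · exact (norm_nonneg _).trans (norm_coeff_negBinomialSeries_le hlam hzR p.1)
  · exact norm_coeff_negBinomialSeries_le hlam hzR p.1
  · exact norm_coeff_negBinomialSeries_le hlam hzR' p.2

end BernsteinEllipse

section Moments

open Module

theorem integral_volumeIoiPow (m : ℕ) (g : ℝ → ℝ) :
    ∫ r : Set.Ioi (0 : ℝ), g r ∂(.volumeIoiPow m) = ∫ r in Set.Ioi (0 : ℝ), r ^ m * g r := by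
  simp only [Measure.volumeIoiPow, ENNReal.ofReal]
  rw [integral_withDensity_eq_integral_smul,
    integral_subtype_comap measurableSet_Ioi fun r : ℝ => Real.toNNReal (r ^ m) • g r,
    setIntegral_congr_fun measurableSet_Ioi fun r hr => ?_]
  · rw [NNReal.smul_def, Real.coe_toNNReal _ (pow_nonneg hr.out.le _), smul_eq_mul]
  · exact (measurable_subtype_coe.pow_const _).real_toNNReal

theorem integral_eq_integral_toSphere_mul_integral_Ioi {E : Type*} [NormedAddCommGroup E]
    [NormedSpace ℝ E] [FiniteDimensional ℝ E] [Nontrivial E] [MeasurableSpace E] [BorelSpace E]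
    (μ : Measure E) [μ.IsAddHaarMeasure] {F : E → ℝ} {f : Metric.sphere (0 : E) 1 → ℝ} {g : ℝ → ℝ}
    (hF : ∀ (x : Metric.sphere (0 : E) 1) (r : ℝ), 0 < r → F (r • (x : E)) = f x * g r) :
    ∫ y, F y ∂μ =
      (∫ x, f x ∂μ.toSphere) * ∫ r in Set.Ioi (0 : ℝ), r ^ (finrank ℝ E - 1) * g r := by
  calc ∫ y, F y ∂μ = ∫ y : ({0}ᶜ : Set E), F y ∂(μ.comap (↑)) := by
        rw [integral_subtype_comap (measurableSet_singleton _).compl F, restrict_compl_singleton]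
    _ = ∫ p : Metric.sphere (0 : E) 1 × Set.Ioi (0 : ℝ), f p.1 * g p.2
          ∂μ.toSphere.prod (.volumeIoiPow (finrank ℝ E - 1)) := by
        rw [← μ.measurePreserving_homeomorphUnitSphereProd.integral_comp
          (Homeomorph.measurableEmbedding _)
          fun p : Metric.sphere (0 : E) 1 × Set.Ioi (0 : ℝ) => f p.1 * g p.2]
        refine integral_congr_ae (ae_of_all _ fun y => ?_)
        have hy : ‖(y : E)‖ ≠ 0 := norm_ne_zero_iff.mpr y.2
        simp only
        rw [← hF _ _ (homeomorphUnitSphereProd E y).2.2]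
        simp [smul_smul, hy]
    _ = _ := by
        rw [integral_prod_mul (L := ℝ) f fun r : Set.Ioi (0 : ℝ) => g r, integral_volumeIoiPow]

theorem integrable_pow_mul_exp_neg_sq (k : ℕ) :
    Integrable fun t : ℝ => t ^ k * Real.exp (-t ^ 2) := by
  have hk : (-1 : ℝ) < k := (by norm_num : (-1 : ℝ) < 0).trans_le k.cast_nonneg
  simpa using integrable_rpow_mul_exp_neg_mul_sq one_pos hk

theorem integral_mul_exp_neg_sq : ∫ t : ℝ, t * Real.exp (-t ^ 2) = 0 := by
  have hodd := integral_neg_eq_self (fun t : ℝ => t * Real.exp (-t ^ 2)) volume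
  simp only [neg_mul, even_two, Even.neg_pow, integral_neg] at hodd
  linarith

theorem integral_pow_add_two_mul_exp_neg_sq (k : ℕ) :
    2 * ∫ t : ℝ, t ^ (k + 2) * Real.exp (-t ^ 2) =
      ((k : ℝ) + 1) * ∫ t : ℝ, t ^ k * Real.exp (-t ^ 2) := by
  have hderiv (t : ℝ) : HasDerivAt (fun t : ℝ => t ^ (k + 1) * Real.exp (-t ^ 2))
      (((k : ℝ) + 1) * (t ^ k * Real.exp (-t ^ 2)) - 2 * (t ^ (k + 2) * Real.exp (-t ^ 2))) t := by
    refine (((hasDerivAt_id' t).fun_pow (k + 1)).fun_mul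
      ((hasDerivAt_id' t).fun_pow 2).fun_neg.exp).congr_deriv ?_
    rw [Nat.add_sub_cancel]
    push_cast
    ring
  have hint := (integrable_pow_mul_exp_neg_sq k).const_mul ((k : ℝ) + 1)
  have hint' := (integrable_pow_mul_exp_neg_sq (k + 2)).const_mul 2
  have hparts := integral_eq_zero_of_hasDerivAt_of_integrable hderiv (hint.sub hint')
    (integrable_pow_mul_exp_neg_sq (k + 1))
  rw [integral_sub hint hint', integral_const_mul, integral_const_mul] at hparts
  linarith

theorem integral_Ioi_pow_mul_exp_neg_sq (k : ℕ) :
    ∫ r in Set.Ioi (0 : ℝ), r ^ k * Real.exp (-r ^ 2) = 1 / 2 * Real.Gamma (((k : ℝ) + 1) / 2) := by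
  have hk : (-1 : ℝ) < k := (by norm_num : (-1 : ℝ) < 0).trans_le k.cast_nonneg
  simpa using integral_rpow_mul_exp_neg_rpow (p := 2) (q := k) two_pos hk

theorem integral_Ioi_pow_mul_exp_neg_sq_pos (k : ℕ) :
    0 < ∫ r in Set.Ioi (0 : ℝ), r ^ k * Real.exp (-r ^ 2) := by
  have := Real.Gamma_pos_of_pos (s := ((k : ℝ) + 1) / 2) (by positivity)
  rw [integral_Ioi_pow_mul_exp_neg_sq]
  positivity

theorem integral_Ioi_pow_add_two_mul_exp_neg_sq (k : ℕ) :
    2 * ∫ r in Set.Ioi (0 : ℝ), r ^ (k + 2) * Real.exp (-r ^ 2) =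
      ((k : ℝ) + 1) * ∫ r in Set.Ioi (0 : ℝ), r ^ k * Real.exp (-r ^ 2) := by
  have hGamma := Real.Gamma_add_one (s := ((k : ℝ) + 1) / 2) (by positivity)
  rw [integral_Ioi_pow_mul_exp_neg_sq, integral_Ioi_pow_mul_exp_neg_sq,
    show ((k + 2 : ℕ) + 1 : ℝ) / 2 = ((k : ℝ) + 1) / 2 + 1 by push_cast; ring, hGamma]
  ring

theorem integral_coord_pow_mul_exp_neg_norm_sq (n k : ℕ) :
    ∫ y : Ambient n, y 0 ^ k * Real.exp (-‖y‖ ^ 2) =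
      (∫ t : ℝ, t ^ k * Real.exp (-t ^ 2)) * (∫ t : ℝ, Real.exp (-t ^ 2)) ^ n := by
  rw [← (PiLp.volume_preserving_toLp (Fin (n + 1))).integral_comp
    (MeasurableEquiv.toLp 2 _).measurableEmbedding]
  let f : Fin (n + 1) → ℝ → ℝ :=
    Fin.cons (fun t => t ^ k * Real.exp (-t ^ 2)) fun _ t => Real.exp (-t ^ 2)
  have hprod (v : Fin (n + 1) → ℝ) : (WithLp.toLp 2 v : Ambient n) 0 ^ k *
      Real.exp (-‖(WithLp.toLp 2 v : Ambient n)‖ ^ 2) = ∏ i, f i (v i) := by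
    rw [EuclideanSpace.norm_sq_eq, Fin.prod_univ_succ, Fin.sum_univ_succ, neg_add, Real.exp_add,
      ← Finset.sum_neg_distrib, Real.exp_sum]
    simp [f, mul_assoc]
  simp_rw [hprod]
  rw [integral_fintype_prod_volume_eq_prod, Fin.prod_univ_succ]
  simp [f]

theorem integral_coord_pow_sphere_mul_integral_Ioi (n k : ℕ) :
    (∫ x : Sph n, (x : Ambient n) 0 ^ k ∂(surf n)) *
        ∫ r in Set.Ioi (0 : ℝ), r ^ (n + k) * Real.exp (-r ^ 2) =
      (∫ t : ℝ, t ^ k * Real.exp (-t ^ 2)) * (∫ t : ℝ, Real.exp (-t ^ 2)) ^ n := by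
  rw [← integral_coord_pow_mul_exp_neg_norm_sq,
    integral_eq_integral_toSphere_mul_integral_Ioi volume
    (f := fun x => (x : Ambient n) 0 ^ k) (g := fun r => r ^ k * Real.exp (-r ^ 2))]
  · simp only [finrank_euclideanSpace, Fintype.card_fin, Nat.add_sub_cancel, pow_add, mul_assoc,
      surf]
  · intro x r hr
    rw [norm_smul, norm_eq_of_mem_sphere x, mul_one, Real.norm_of_nonneg hr.le, PiLp.smul_apply,
      smul_eq_mul, mul_pow]
    ring

theorem integral_coord_sphere (n : ℕ) : ∫ x : Sph n, (x : Ambient n) 0 ∂(surf n) = 0 := by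
  have h := integral_coord_pow_sphere_mul_integral_Ioi n 1
  simp only [pow_one, integral_mul_exp_neg_sq, zero_mul] at h
  exact (mul_eq_zero.mp h).resolve_right (integral_Ioi_pow_mul_exp_neg_sq_pos _).ne'

theorem integral_coord_pow_add_two_sphere (n k : ℕ) :
    ((n : ℝ) + k + 1) * ∫ x : Sph n, (x : Ambient n) 0 ^ (k + 2) ∂(surf n) =
      ((k : ℝ) + 1) * ∫ x : Sph n, (x : Ambient n) 0 ^ k ∂(surf n) := by
  have hk := integral_coord_pow_sphere_mul_integral_Ioi n k
  have hk' := integral_coord_pow_sphere_mul_integral_Ioi n (k + 2)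
  have hline := integral_pow_add_two_mul_exp_neg_sq k
  have hray := integral_Ioi_pow_add_two_mul_exp_neg_sq (n + k)
  rw [← add_assoc] at hk'
  push_cast at hray
  refine mul_right_cancel₀ (integral_Ioi_pow_mul_exp_neg_sq_pos (n + k)).ne' ?_
  generalize (∫ t : ℝ, Real.exp (-t ^ 2)) ^ n = g at *
  linear_combination 2 * hk' - ((k : ℝ) + 1) * hk + g * hline -
    (∫ x : Sph n, (x : Ambient n) 0 ^ (k + 2) ∂(surf n)) * hray

end Moments

section Orthogonality

open Polynomial

instance (n : ℕ) : IsFiniteMeasure (surf n) := by unfold surf; infer_instance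

theorem integrable_of_continuous_sphere {n : ℕ} {F : Type*} [NormedAddCommGroup F]
    {f : Sph n → F} (hf : Continuous f) : Integrable f (surf n) :=
  hf.integrable_of_hasCompactSupport (HasCompactSupport.of_compactSpace f)

theorem continuous_eval_coord (n : ℕ) (p : ℝ[X]) :
    Continuous fun x : Sph n => p.eval ((x : Ambient n) 0) :=
  p.continuous.comp (by fun_prop)

/-- The integral over the sphere of the zonal function `x ↦ p (x 0)`, as a linear functional
of `p`. -/
def zonalIntegral (n : ℕ) : ℝ[X] →ₗ[ℝ] ℝ where
  toFun p := ∫ x : Sph n, p.eval ((x : Ambient n) 0) ∂(surf n)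
  map_add' p q := by
    simp only [eval_add]
    exact integral_add (integrable_of_continuous_sphere (continuous_eval_coord n p))
      (integrable_of_continuous_sphere (continuous_eval_coord n q))
  map_smul' a p := by
    simp only [eval_smul, smul_eq_mul, RingHom.id_apply]
    exact integral_const_mul _ _

theorem zonalIntegral_X_pow (n k : ℕ) :
    zonalIntegral n (X ^ k) = ∫ x : Sph n, (x : Ambient n) 0 ^ k ∂(surf n) := by
  simp [zonalIntegral]

theorem zonalIntegral_divergence (n : ℕ) (p : ℝ[X]) :
    zonalIntegral n ((1 - X ^ 2) * derivative p - C (n : ℝ) * X * p) = 0 := by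
  induction p using Polynomial.induction_on' with
  | add p q hp hq =>
    have hsplit : (1 - X ^ 2) * derivative (p + q) - C (n : ℝ) * X * (p + q) =
        ((1 - X ^ 2) * derivative p - C (n : ℝ) * X * p) +
          ((1 - X ^ 2) * derivative q - C (n : ℝ) * X * q) := by
      rw [derivative_add]; ring
    rw [hsplit, map_add, hp, hq, add_zero]
  | monomial k a =>
    match k with
    | 0 =>
      have hfield : (1 - X ^ 2) * derivative (monomial 0 a) - C (n : ℝ) * X * monomial 0 a =
          (-(n * a)) • (X ^ 1 : ℝ[X]) := by
        rw [monomial_zero_left, derivative_C, smul_eq_C_mul]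
        simp only [mul_zero, map_natCast, zero_sub, map_neg, map_mul, pow_one, neg_mul, neg_inj]
        ring
      rw [hfield, map_smul, zonalIntegral_X_pow]
      simp only [pow_one, integral_coord_sphere, smul_zero]
    | k + 1 =>
      have hfield : (1 - X ^ 2) * derivative (monomial (k + 1) a) -
          C (n : ℝ) * X * monomial (k + 1) a =
          (a * (k + 1)) • (X ^ k : ℝ[X]) - (a * (n + k + 1)) • X ^ (k + 2) := by
        rw [derivative_monomial, ← C_mul_X_pow_eq_monomial, ← C_mul_X_pow_eq_monomial,
          smul_eq_C_mul, smul_eq_C_mul]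
        simp only [C_mul, C_add, C_1, Nat.cast_add, Nat.cast_one, Nat.add_one_sub_one]
        ring
      rw [hfield, map_sub, map_smul, map_smul, zonalIntegral_X_pow, zonalIntegral_X_pow,
        smul_eq_mul, smul_eq_mul]
      linear_combination -a * integral_coord_pow_add_two_sphere n k

theorem two_mul_order (n : ℕ) : 2 * order n = n - 1 := by rw [order]; ring

theorem order_pos {n : ℕ} (hn : 2 ≤ n) : 0 < order n := by
  have : (2 : ℝ) ≤ n := by exact_mod_cast hn
  rw [order]; linarith

/-- The operator `p ↦ (1 - X²) p'' - n X p'` is symmetric for `zonalIntegral`, and the Gegenbauer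
polynomials are eigenvectors for distinct eigenvalues. -/
theorem zonalIntegral_gegenbauerPoly_mul_of_ne {n : ℕ} (hn : 2 ≤ n) {l m : ℕ} (hlm : l ≠ m) :
    zonalIntegral n (gegenbauerPoly (order n) l * gegenbauerPoly (order n) m) = 0 := by
  set P := gegenbauerPoly (order n)
  have hl := gegenbauerPoly_ode (order n) l
  have hm := gegenbauerPoly_ode (order n) m
  rw [two_mul_order, sub_add_cancel] at hl hm
  have hdiv := zonalIntegral_divergence n (P m * derivative (P l) - P l * derivative (P m))
  have hwronskian : (1 - X ^ 2) * derivative (P m * derivative (P l) - P l * derivative (P m))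
      - C (n : ℝ) * X * (P m * derivative (P l) - P l * derivative (P m)) =
      (((m : ℝ) - l) * (m + l + 2 * order n)) • (P l * P m) := by
    have heigen : ((m : ℝ) - l) * (m + l + 2 * order n) =
        m * (m + (n - 1)) - l * (l + (n - 1)) := by rw [two_mul_order]; ring
    rw [heigen, derivative_sub, derivative_mul, derivative_mul, smul_eq_C_mul, C_sub]
    linear_combination P m * hl - P l * hm
  rw [hwronskian, map_smul, smul_eq_mul, mul_eq_zero] at hdiv
  refine hdiv.resolve_left (mul_ne_zero (sub_ne_zero.mpr (by exact_mod_cast hlm.symm)) ?_)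
  have := order_pos hn
  positivity

/-- The squared norm of `x ↦ C_l^λ (x 0)` in `L²(𝒮^n)`. -/
def gegenbauerSqNorm (n l : ℕ) : ℝ :=
  zonalIntegral n (gegenbauerPoly (order n) l * gegenbauerPoly (order n) l)

theorem zonalIntegral_X_mul_eq_gegenbauerSqNorm_succ {n : ℕ} (hn : 2 ≤ n) (l : ℕ) :
    2 * ((l : ℝ) + order n) *
        zonalIntegral n (X * gegenbauerPoly (order n) l * gegenbauerPoly (order n) (l + 1)) =
      (l + 1) * gegenbauerSqNorm n (l + 1) := by
  set P := gegenbauerPoly (order n) with hP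
  match l with
  | 0 =>
    have hrec : (2 * order n) • (X * P 0 * P 1) = P 1 * P 1 := by
      rw [smul_eq_C_mul]; simp only [hP, gegenbauerPoly]; ring
    simpa [gegenbauerSqNorm] using congrArg (zonalIntegral n) hrec
  | l + 1 =>
    have hrec : (2 * ((l : ℝ) + 1 + order n)) • (X * P (l + 1) * P (l + 2)) =
        ((l : ℝ) + 2) • (P (l + 2) * P (l + 2)) + ((l : ℝ) + 2 * order n) • (P l * P (l + 2)) := by
      simp only [smul_eq_C_mul]
      linear_combination -P (l + 2) * gegenbauerPoly_add_two (order n) l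
    have hint := congrArg (zonalIntegral n) hrec
    simp only [map_add, map_smul, smul_eq_mul] at hint
    rw [zonalIntegral_gegenbauerPoly_mul_of_ne hn (by omega : l ≠ l + 2)] at hint
    rw [gegenbauerSqNorm]
    push_cast
    linear_combination hint

theorem zonalIntegral_X_mul_eq_gegenbauerSqNorm {n : ℕ} (hn : 2 ≤ n) (l : ℕ) :
    2 * ((l : ℝ) + 1 + order n) *
        zonalIntegral n (X * gegenbauerPoly (order n) l * gegenbauerPoly (order n) (l + 1)) =
      (l + 2 * order n) * gegenbauerSqNorm n l := by
  set P := gegenbauerPoly (order n)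
  have hrec : (2 * ((l : ℝ) + 1 + order n)) • (X * P l * P (l + 1)) =
      ((l : ℝ) + 2) • (P (l + 2) * P l) + ((l : ℝ) + 2 * order n) • (P l * P l) := by
    simp only [smul_eq_C_mul]
    linear_combination -P l * gegenbauerPoly_add_two (order n) l
  have hint := congrArg (zonalIntegral n) hrec
  simp only [map_add, map_smul, smul_eq_mul] at hint
  rw [zonalIntegral_gegenbauerPoly_mul_of_ne hn (by omega : l + 2 ≠ l)] at hint
  rw [gegenbauerSqNorm]
  linear_combination hint

theorem gegenbauerSqNorm_succ {n : ℕ} (hn : 2 ≤ n) (l : ℕ) :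
    ((l : ℝ) + 1) * (l + 1 + order n) * gegenbauerSqNorm n (l + 1) =
      (l + order n) * (l + 2 * order n) * gegenbauerSqNorm n l := by
  linear_combination (l + order n) * zonalIntegral_X_mul_eq_gegenbauerSqNorm hn l
    - ((l : ℝ) + 1 + order n) * zonalIntegral_X_mul_eq_gegenbauerSqNorm_succ hn l

theorem gegenbauerSqNorm_eq {n : ℕ} (hn : 2 ≤ n) (l : ℕ) :
    (l + order n) * (l + 2 * order n) * gegenbauerSqNorm n l =
      2 * order n ^ 2 * gegenbauerSqNorm n 0 * ((l + n - 1).choose (n - 1) : ℝ) := by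
  obtain ⟨m, rfl⟩ : ∃ m, n = m + 1 := ⟨n - 1, by omega⟩
  have hsub (l : ℕ) : l + (m + 1) - 1 = l + m := by omega
  simp only [hsub, Nat.add_sub_cancel]
  induction l with
  | zero => rw [zero_add, Nat.choose_self]; push_cast; ring
  | succ l ih =>
    have hnorm := gegenbauerSqNorm_succ hn l
    have hchoose : ((l : ℝ) + 1) * ((l + 1 + m).choose m : ℝ) =
        (l + 1 + m) * ((l + m).choose m : ℝ) := by
      have h := Nat.add_one_mul_choose_eq (l + m) l
      rw [Nat.choose_symm_add, add_right_comm l m 1, Nat.choose_symm_add] at h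
      have h' := congrArg (Nat.cast (R := ℝ)) h
      push_cast at h'
      linear_combination -h'
    have horder := two_mul_order (m + 1)
    push_cast at horder
    refine mul_left_cancel₀ (by positivity : (l : ℝ) + 1 ≠ 0) ?_
    push_cast
    rw [horder] at *
    linear_combination ((l : ℝ) + 1 + m) * hnorm + ((l : ℝ) + 1 + m) * ih
      - 2 * order (m + 1) ^ 2 * gegenbauerSqNorm (m + 1) 0 * hchoose

theorem gegenbauerSqNorm_zero_pos (n : ℕ) : 0 < gegenbauerSqNorm n 0 := by
  have : NeZero (surf n) := ⟨Measure.toSphere_ne_zero _⟩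
  simp [gegenbauerSqNorm, gegenbauerPoly, zonalIntegral]

end Orthogonality

section ZonalLaplacian

theorem hasDerivAt_add_smul {E : Type*} [NormedAddCommGroup E] [NormedSpace ℝ E] (x v : E) (s : ℝ) :
    HasDerivAt (fun s : ℝ => x + s • v) v s := by
  simpa using ((hasDerivAt_id' s).smul_const v).const_add x

theorem iteratedFDeriv_two_eq_of_hasDerivAt_line {E : Type*} [NormedAddCommGroup E]
    [NormedSpace ℝ E] {g : E → ℝ} {x v : E} (hg : ContDiffAt ℝ 2 g x) {φ' : ℝ → ℝ} {d : ℝ}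
    (hφ : ∀ᶠ s in 𝓝 (0 : ℝ), HasDerivAt (fun s : ℝ => g (x + s • v)) (φ' s) s)
    (hφ' : HasDerivAt φ' d 0) : iteratedFDeriv ℝ 2 g x ![v, v] = d := by
  rw [iteratedFDeriv_two_apply]
  simp only [Matrix.cons_val_zero, Matrix.cons_val_one]
  have hline : Tendsto (fun s : ℝ => x + s • v) (𝓝 0) (𝓝 x) := by
    simpa using (hasDerivAt_add_smul x v 0).continuousAt.tendsto
  have hdiff : ∀ᶠ s in 𝓝 (0 : ℝ), DifferentiableAt ℝ g (x + s • v) :=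
    hline.eventually ((hg.eventually (by simp)).mono fun y hy => hy.differentiableAt (by simp))
  have hφ'_eq : φ' =ᶠ[𝓝 0] fun s => fderiv ℝ g (x + s • v) v := by
    filter_upwards [hφ, hdiff] with s hs hgs
    exact hs.unique (hgs.hasFDerivAt.comp_hasDerivAt s (hasDerivAt_add_smul x v s))
  have hfderiv : DifferentiableAt ℝ (fderiv ℝ g) (x + (0 : ℝ) • v) := by
    rw [zero_smul, add_zero]
    exact (hg.fderiv_right (m := 1) (by norm_num)).differentiableAt (by simp)
  have hderiv : HasDerivAt (fun s : ℝ => fderiv ℝ g (x + s • v) v)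
      (fderiv ℝ (fderiv ℝ g) (x + (0 : ℝ) • v) v v) 0 :=
    (ContinuousLinearMap.apply ℝ ℝ v).hasFDerivAt.comp_hasDerivAt 0
      (hfderiv.hasFDerivAt.comp_hasDerivAt 0 (hasDerivAt_add_smul x v 0))
  simpa using (hderiv.congr_of_eventuallyEq hφ'_eq).unique hφ'

theorem exists_hasDerivAt_comp_and_hasDerivAt {F u u' : ℝ → ℝ} {s₀ u'' : ℝ}
    (hF : ContDiffAt ℝ 2 F (u s₀)) (hu : ∀ᶠ s in 𝓝 s₀, HasDerivAt u (u' s) s)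
    (hu' : HasDerivAt u' u'' s₀) :
    ∃ φ' : ℝ → ℝ, (∀ᶠ s in 𝓝 s₀, HasDerivAt (fun s => F (u s)) (φ' s) s) ∧
      HasDerivAt φ' (deriv (deriv F) (u s₀) * u' s₀ ^ 2 + deriv F (u s₀) * u'') s₀ := by
  have hus₀ := hu.self_of_nhds
  have hFu : ∀ᶠ s in 𝓝 s₀, DifferentiableAt ℝ F (u s) :=
    hus₀.continuousAt.eventually
      ((hF.eventually (by simp)).mono fun y hy => hy.differentiableAt (by simp))
  have hF' : DifferentiableAt ℝ (deriv F) (u s₀) := by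
    have : ContDiffAt ℝ 1 (deriv F) (u s₀) :=
      (hF.fderiv_right (m := 1) (by norm_num)).clm_apply contDiffAt_const
    exact this.differentiableAt (by simp)
  refine ⟨fun s => deriv F (u s) * u' s, ?_, ?_⟩
  · filter_upwards [hu, hFu] with s hs hFs
    exact hFs.hasDerivAt.comp s hs
  · refine ((hF'.hasDerivAt.comp s₀ hus₀).fun_mul hu').congr_deriv ?_
    simp only [Function.comp_apply]
    ring

theorem exists_hasDerivAt_linear_mul_rpow_and_hasDerivAt (t w b : ℝ) :
    ∃ u' : ℝ → ℝ, (∀ᶠ s in 𝓝 (0 : ℝ), HasDerivAt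
        (fun s : ℝ => (t + s * w) * (1 + 2 * b * s + s ^ 2) ^ (-(1 / 2) : ℝ)) (u' s) s) ∧
      u' 0 = w - t * b ∧ HasDerivAt u' (-2 * w * b - t + 3 * t * b ^ 2) 0 := by
  set N : ℝ → ℝ := fun s => 1 + 2 * b * s + s ^ 2 with hN
  have hN0 : N 0 = 1 := by simp [hN]
  have hN' (s : ℝ) : HasDerivAt N (2 * b + 2 * s) s := by
    simpa using
      (((hasDerivAt_id' s).const_mul (2 * b)).const_add 1).fun_add ((hasDerivAt_id' s).fun_pow 2)
  have hNpos : ∀ᶠ s in 𝓝 (0 : ℝ), 0 < N s :=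
    (hN' 0).continuousAt.eventually (lt_mem_nhds (by rw [hN0]; exact one_pos))
  have hpow {s : ℝ} (hs : 0 < N s) (p : ℝ) :
      HasDerivAt (fun s => N s ^ p) ((2 * b + 2 * s) * p * N s ^ (p - 1)) s :=
    (hN' s).rpow_const (Or.inl hs.ne')
  have hlin (s : ℝ) : HasDerivAt (fun s : ℝ => t + s * w) w s := by
    simpa using ((hasDerivAt_id' s).mul_const w).const_add t
  refine ⟨fun s => w * N s ^ (-(1 / 2) : ℝ) - (t + s * w) * (b + s) * N s ^ (-(3 / 2) : ℝ),
    ?_, by simp [hN0], ?_⟩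
  · filter_upwards [hNpos] with s hs
    refine ((hlin s).fun_mul (hpow hs _)).congr_deriv ?_
    rw [show (-(1 / 2) - 1 : ℝ) = -(3 / 2) by norm_num]
    ring
  · have h0 : 0 < N 0 := hNpos.self_of_nhds
    refine (((hpow h0 _).const_mul w).fun_sub
      (((hlin 0).fun_mul ((hasDerivAt_id' 0).const_add b)).fun_mul (hpow h0 _))).congr_deriv ?_
    simp only [hN0, Real.one_rpow]
    ring

theorem sum_coord_sq_sphere {n : ℕ} (x : Sph n) : ∑ i, (x : Ambient n) i ^ 2 = 1 := by
  have h := EuclideanSpace.norm_sq_eq (x : Ambient n)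
  rw [norm_eq_of_mem_sphere x] at h
  simpa using h.symm

theorem abs_coord_le_one {n : ℕ} (x : Sph n) (i : Fin (n + 1)) : |(x : Ambient n) i| ≤ 1 := by
  simpa [norm_eq_of_mem_sphere x] using PiLp.norm_apply_le (x : Ambient n) i

theorem norm_inv_add_smul_basisFun {n : ℕ} (x : Sph n) (i : Fin (n + 1)) (s : ℝ) :
    ‖(x : Ambient n) + s • EuclideanSpace.basisFun (Fin (n + 1)) ℝ i‖⁻¹ =
      (1 + 2 * (x : Ambient n) i * s + s ^ 2) ^ (-(1 / 2) : ℝ) := by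
  have hsq : ‖(x : Ambient n) + s • EuclideanSpace.basisFun (Fin (n + 1)) ℝ i‖ ^ 2 =
      1 + 2 * (x : Ambient n) i * s + s ^ 2 := by
    rw [norm_add_sq_real, norm_eq_of_mem_sphere x, real_inner_smul_right, norm_smul]
    simp [EuclideanSpace.inner_single_right]
    ring
  rw [← hsq, ← Real.rpow_natCast, ← Real.rpow_mul (norm_nonneg _), ← Real.rpow_neg_one]
  norm_num

theorem contDiffAt_zonal {n : ℕ} {F : ℝ → ℝ} {k : WithTop ℕ∞} (x : Sph n)
    (hF : ContDiffAt ℝ k F ((x : Ambient n) 0)) :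
    ContDiffAt ℝ k (fun y : Ambient n => F (‖y‖⁻¹ * y 0)) x := by
  have hx : ‖(x : Ambient n)‖ = 1 := norm_eq_of_mem_sphere x
  have hx0 : (x : Ambient n) ≠ 0 := norm_ne_zero_iff.mp (by rw [hx]; exact one_ne_zero)
  have hcoord : ContDiffAt ℝ k (fun y : Ambient n => ‖y‖⁻¹ * y 0) x :=
    ((contDiffAt_norm ℝ hx0).inv (by rw [hx]; exact one_ne_zero)).mul (by fun_prop)
  exact ContDiffAt.comp (x : Ambient n) (by simpa [hx] using hF) hcoord

theorem iteratedFDeriv_two_zonal {n : ℕ} {F : ℝ → ℝ} (x : Sph n)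
    (hF : ContDiffAt ℝ 2 F ((x : Ambient n) 0)) (i : Fin (n + 1)) :
    iteratedFDeriv ℝ 2 (fun y : Ambient n => F (‖y‖⁻¹ * y 0)) x
        ![EuclideanSpace.basisFun (Fin (n + 1)) ℝ i, EuclideanSpace.basisFun (Fin (n + 1)) ℝ i] =
      deriv (deriv F) ((x : Ambient n) 0) *
          ((if i = 0 then 1 else 0) - (x : Ambient n) 0 * (x : Ambient n) i) ^ 2 +
        deriv F ((x : Ambient n) 0) * (-2 * (if i = 0 then 1 else 0) * (x : Ambient n) i
          - (x : Ambient n) 0 + 3 * (x : Ambient n) 0 * (x : Ambient n) i ^ 2) := by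
  obtain ⟨u', hu, hu0, hu'⟩ := exists_hasDerivAt_linear_mul_rpow_and_hasDerivAt
    ((x : Ambient n) 0) (if i = 0 then 1 else 0) ((x : Ambient n) i)
  obtain ⟨φ', hφ, hφ'⟩ := exists_hasDerivAt_comp_and_hasDerivAt (F := F) (by simpa using hF) hu hu'
  simp only [hu0, zero_mul, add_zero, mul_zero, zero_pow two_ne_zero, Real.one_rpow, mul_one]
    at hφ'
  refine iteratedFDeriv_two_eq_of_hasDerivAt_line (contDiffAt_zonal x hF) (φ' := φ') ?_ hφ'
  convert hφ using 4 with _ s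
  rw [norm_inv_add_smul_basisFun, mul_comm]
  congr 1
  rcases eq_or_ne i 0 with rfl | hi
  · simp
  · simp [hi, hi.symm]

theorem radialExt_zonal_eventuallyEq {n : ℕ} (F : ℝ → ℝ) (x : Sph n) :
    radialExt (fun y : Sph n => F ((y : Ambient n) 0)) =ᶠ[𝓝 (x : Ambient n)]
      fun y => F (‖y‖⁻¹ * y 0) := by
  have hx0 : (x : Ambient n) ≠ 0 := ne_zero_of_mem_unit_sphere x
  filter_upwards [isOpen_ne.mem_nhds hx0] with y hy
  simp only [radialExt, dif_pos hy]
  simp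

theorem laplaceBeltrami_zonal {n : ℕ} {F : ℝ → ℝ} (x : Sph n)
    (hF : ContDiffAt ℝ 2 F ((x : Ambient n) 0)) :
    laplaceBeltrami (fun y : Sph n => F ((y : Ambient n) 0)) x =
      (1 - (x : Ambient n) 0 ^ 2) * deriv (deriv F) ((x : Ambient n) 0) -
        n * (x : Ambient n) 0 * deriv F ((x : Ambient n) 0) := by
  rw [laplaceBeltrami,
    (InnerProductSpace.laplacian_congr_nhds (radialExt_zonal_eventuallyEq F x)).eq_of_nhds,
    InnerProductSpace.laplacian_eq_iteratedFDeriv_orthonormalBasis _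
      (EuclideanSpace.basisFun (Fin (n + 1)) ℝ)]
  simp only [iteratedFDeriv_two_zonal x hF]
  have hsum := sum_coord_sq_sphere x
  rw [Fin.sum_univ_succ] at hsum ⊢
  simp only [if_true, Fin.succ_ne_zero, if_false, zero_sub, neg_sq, mul_pow, mul_zero, zero_mul,
    Finset.sum_add_distrib, ← Finset.mul_sum, eq_sub_of_add_eq' hsum, Finset.sum_const,
    Finset.card_univ, Fintype.card_fin, nsmul_eq_mul]
  ring

end ZonalLaplacian

section GeometricDecay

/-- The sequence `α` decays at least geometrically. This is the class of coefficients for which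
zonal series are manipulated: it is stable under multiplication by polynomially bounded factors. -/
def GeometricDecay (α : ℕ → ℝ) : Prop :=
  ∃ θ ∈ Set.Ioo (0 : ℝ) 1, α =O[atTop] fun l => θ ^ l

namespace GeometricDecay

variable {α β : ℕ → ℝ}

theorem summable (h : GeometricDecay α) : Summable α := by
  obtain ⟨θ, ⟨h0, h1⟩, hα⟩ := h
  exact summable_of_isBigO_nat (summable_geometric_of_lt_one h0.le h1) hα

theorem summable_abs (h : GeometricDecay α) : Summable fun l => |α l| := h.summable.abs

theorem exists_mul_pow (h : GeometricDecay α) :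
    ∃ R : ℝ, 1 < R ∧ GeometricDecay fun l => α l * R ^ l := by
  obtain ⟨θ, ⟨h0, h1⟩, hα⟩ := h
  have hs0 : 0 < √θ := Real.sqrt_pos.mpr h0
  have hs1 : √θ < 1 := by rw [Real.sqrt_lt' one_pos]; simpa using h1
  refine ⟨(√θ)⁻¹, (one_lt_inv₀ hs0).mpr hs1, √θ, ⟨hs0, hs1⟩, ?_⟩
  refine (hα.mul (isBigO_refl _ _)).congr_right fun l => ?_
  rw [← mul_pow, ← div_eq_mul_inv, Real.div_sqrt]

theorem mul_of_isBigO_pow (hα : GeometricDecay α) {m : ℕ}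
    (hβ : β =O[atTop] fun l : ℕ => (l : ℝ) ^ m) : GeometricDecay fun l => α l * β l := by
  obtain ⟨θ, ⟨h0, h1⟩, hα⟩ := hα
  obtain ⟨θ', hθ, hθ'⟩ := exists_between h1
  refine ⟨θ', ⟨h0.trans hθ, hθ'⟩, (hα.mul hβ).trans ?_⟩
  simpa only [mul_comm] using (isLittleO_pow_const_mul_const_pow_const_pow_of_norm_lt m
    (by rwa [Real.norm_of_nonneg h0.le] : ‖θ‖ < θ')).isBigO

theorem mul (hα : GeometricDecay α) (hβ : GeometricDecay β) :
    GeometricDecay fun l => α l * β l := by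
  refine hα.mul_of_isBigO_pow (m := 0) ?_
  simpa only [pow_zero] using hβ.summable.tendsto_atTop_zero.isBigO_one ℝ

theorem comp_succ (hα : GeometricDecay α) : GeometricDecay fun l => α (l + 1) := by
  obtain ⟨θ, hθ, hα⟩ := hα
  refine ⟨θ, hθ, (hα.comp_tendsto (tendsto_add_atTop_nat 1)).trans ?_⟩
  simpa only [Function.comp_def, pow_succ, mul_comm] using
    isBigO_const_mul_self θ (fun l : ℕ => θ ^ l) atTop

end GeometricDecay

theorem isBigO_natCast_add_const (a : ℝ) :
    (fun l : ℕ => (l : ℝ) + a) =O[atTop] fun l : ℕ => (l : ℝ) :=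
  (isBigO_refl _ _).add
    ((isLittleO_const_id_atTop a).comp_tendsto tendsto_natCast_atTop_atTop).isBigO

theorem isBigO_eval_one_gegenbauerPoly {lam : ℝ} (hlam : 0 ≤ lam) {m : ℕ}
    (hm : 2 * lam ≤ m + 1) :
    (fun l => (gegenbauerPoly lam l).eval 1) =O[atTop] fun l : ℕ => (l : ℝ) ^ m := by
  refine (IsBigO.of_bound 1 (Eventually.of_forall fun l => ?_)).trans
    ((isBigO_natCast_add_const 1).pow m)
  rw [one_mul, Real.norm_of_nonneg (eval_one_gegenbauerPoly_nonneg hlam l),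
    Real.norm_of_nonneg (by positivity)]
  exact eval_one_gegenbauerPoly_le hlam hm l

end GeometricDecay

section ZonalSeries

open Polynomial

/-- The profile `∑ α_l C_l^lam` of a zonal function. -/
def gegenbauerSeries (lam : ℝ) (α : ℕ → ℝ) (t : ℝ) : ℝ :=
  ∑' l, α l * (gegenbauerPoly lam l).eval t

/-- The holomorphic extension of `gegenbauerSeries lam α` to a complex neighbourhood of
`[-1, 1]`. -/
def complexGegenbauerSeries (lam : ℝ) (α : ℕ → ℝ) (z : ℂ) : ℂ :=
  ∑' l, (α l : ℂ) * aeval z (gegenbauerPoly lam l)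

theorem re_ofReal_mul_aeval_ofReal (a : ℝ) (p : ℝ[X]) (t : ℝ) :
    ((a : ℂ) * aeval (t : ℂ) p).re = a * p.eval t := by
  rw [Complex.re_ofReal_mul, ← Complex.coe_algebraMap, aeval_algebraMap_apply,
    Complex.coe_algebraMap, Complex.ofReal_re, coe_aeval_eq_eval]

variable {lam : ℝ} {α : ℕ → ℝ} {p : ℕ → ℝ[X]} {Φ : ℂ → ℂ} {U : Set ℂ}

theorem hasDerivAt_sum_mul_aeval (α : ℕ → ℝ) (p : ℕ → ℝ[X]) (s : Finset ℕ) (z : ℂ) :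
    HasDerivAt (fun z : ℂ => ∑ l ∈ s, (α l : ℂ) * aeval z (p l))
      (∑ l ∈ s, (α l : ℂ) * aeval z (derivative (p l))) z :=
  HasDerivAt.fun_sum fun l _ => ((p l).hasDerivAt_aeval z).const_mul _

theorem differentiableOn_of_tendstoLocallyUniformlyOn_sum_mul_aeval (hU : IsOpen U)
    (h : TendstoLocallyUniformlyOn
      (fun (s : Finset ℕ) (z : ℂ) => ∑ l ∈ s, (α l : ℂ) * aeval z (p l)) Φ atTop U) :
    DifferentiableOn ℂ Φ U :=
  h.differentiableOn (Eventually.of_forall fun s z _ =>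
    (hasDerivAt_sum_mul_aeval α p s z).differentiableAt.differentiableWithinAt) hU

theorem tendstoLocallyUniformlyOn_sum_mul_aeval_derivative (hU : IsOpen U)
    (h : TendstoLocallyUniformlyOn
      (fun (s : Finset ℕ) (z : ℂ) => ∑ l ∈ s, (α l : ℂ) * aeval z (p l)) Φ atTop U) :
    TendstoLocallyUniformlyOn
      (fun (s : Finset ℕ) (z : ℂ) => ∑ l ∈ s, (α l : ℂ) * aeval z (derivative (p l)))
      (deriv Φ) atTop U := by
  have hderiv := h.deriv (Eventually.of_forall fun s z _ =>
    (hasDerivAt_sum_mul_aeval α p s z).differentiableAt.differentiableWithinAt) hU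
  exact hderiv.congr fun s z _ => (hasDerivAt_sum_mul_aeval α p s z).deriv

theorem hasSum_re_of_tendstoLocallyUniformlyOn_sum_mul_aeval {t : ℝ} (ht : (t : ℂ) ∈ U)
    (h : TendstoLocallyUniformlyOn
      (fun (s : Finset ℕ) (z : ℂ) => ∑ l ∈ s, (α l : ℂ) * aeval z (p l)) Φ atTop U) :
    HasSum (fun l => α l * (p l).eval t) (Φ t).re := by
  have hsum : HasSum (fun l => (α l : ℂ) * aeval (t : ℂ) (p l)) (Φ t) := by
    rw [HasSum, SummationFilter.unconditional_filter]
    exact h.tendsto_at ht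
  simpa only [re_ofReal_mul_aeval_ofReal] using Complex.hasSum_re hsum

theorem deriv_re_comp_ofReal {t : ℝ} (h : DifferentiableAt ℂ Φ t) :
    deriv (fun s : ℝ => (Φ s).re) t = (deriv Φ t).re :=
  h.hasDerivAt.real_of_complex.deriv

theorem exists_summable_bound_bernsteinEllipse (hlam : 0 ≤ lam) (hα : GeometricDecay α) :
    ∃ R : ℝ, 1 < R ∧ ∃ u : ℕ → ℝ, Summable u ∧ ∀ l, ∀ z ∈ bernsteinEllipse R,
      ‖(α l : ℂ) * aeval z (gegenbauerPoly lam l)‖ ≤ u l := by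
  obtain ⟨R, hR, hdecay⟩ := hα.exists_mul_pow
  obtain ⟨m, hm⟩ := exists_nat_ge (2 * lam)
  refine ⟨R, hR, _, (hdecay.mul_of_isBigO_pow
    (isBigO_eval_one_gegenbauerPoly hlam (m := m) (by linarith))).summable_abs, fun l z hz => ?_⟩
  rw [norm_mul, Complex.norm_real, Real.norm_eq_abs, mul_assoc, abs_mul (α l)]
  gcongr
  exact (norm_aeval_gegenbauerPoly_le hlam hR hz l).trans (le_abs_self _)

theorem exists_summable_bound_gegenbauerPoly (hlam : 0 ≤ lam) (hα : GeometricDecay α) :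
    ∃ u : ℕ → ℝ, Summable u ∧ ∀ l, ∀ t : ℝ, |t| ≤ 1 →
      |α l * (gegenbauerPoly lam l).eval t| ≤ u l := by
  obtain ⟨R, hR, u, hu, hle⟩ := exists_summable_bound_bernsteinEllipse hlam hα
  refine ⟨u, hu, fun l t ht => ?_⟩
  rw [← re_ofReal_mul_aeval_ofReal]
  exact (Complex.abs_re_le_norm _).trans (hle l t (ofReal_mem_bernsteinEllipse hR ht))

theorem hasSum_gegenbauerSeries (hlam : 0 ≤ lam) (hα : GeometricDecay α) {t : ℝ}
    (ht : |t| ≤ 1) :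
    HasSum (fun l => α l * (gegenbauerPoly lam l).eval t) (gegenbauerSeries lam α t) := by
  obtain ⟨u, hu, hle⟩ := exists_summable_bound_gegenbauerPoly hlam hα
  exact (Summable.of_norm_bounded hu fun l => hle l t ht).hasSum

theorem exists_tendstoLocallyUniformlyOn_complexGegenbauerSeries (hlam : 0 ≤ lam)
    (hα : GeometricDecay α) : ∃ U : Set ℂ, IsOpen U ∧ (∀ t : ℝ, |t| ≤ 1 → (t : ℂ) ∈ U) ∧
      TendstoLocallyUniformlyOn
        (fun (s : Finset ℕ) (z : ℂ) => ∑ l ∈ s, (α l : ℂ) * aeval z (gegenbauerPoly lam l))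
        (complexGegenbauerSeries lam α) atTop U := by
  obtain ⟨R, hR, u, hu, hle⟩ := exists_summable_bound_bernsteinEllipse hlam hα
  exact ⟨bernsteinEllipse R, isOpen_bernsteinEllipse R,
    fun t ht => ofReal_mem_bernsteinEllipse hR ht,
    (tendstoUniformlyOn_tsum hu hle).tendstoLocallyUniformlyOn⟩

theorem gegenbauerSeries_eventuallyEq_re (hU : IsOpen U) {t : ℝ} (ht : (t : ℂ) ∈ U)
    (h : TendstoLocallyUniformlyOn
      (fun (s : Finset ℕ) (z : ℂ) => ∑ l ∈ s, (α l : ℂ) * aeval z (gegenbauerPoly lam l)) Φ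
        atTop U) :
    gegenbauerSeries lam α =ᶠ[𝓝 t] fun s : ℝ => (Φ s).re := by
  filter_upwards [Complex.continuous_ofReal.continuousAt.eventually (hU.mem_nhds ht)] with s hs
  exact (hasSum_re_of_tendstoLocallyUniformlyOn_sum_mul_aeval hs h).tsum_eq

theorem contDiffAt_gegenbauerSeries (hlam : 0 ≤ lam) (hα : GeometricDecay α) {t : ℝ}
    (ht : |t| ≤ 1) : ContDiffAt ℝ ∞ (gegenbauerSeries lam α) t := by
  obtain ⟨U, hU, hmem, h⟩ := exists_tendstoLocallyUniformlyOn_complexGegenbauerSeries hlam hα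
  have hΦ := differentiableOn_of_tendstoLocallyUniformlyOn_sum_mul_aeval hU h
  have hsmooth : ContDiffAt ℂ ∞ (complexGegenbauerSeries lam α) t :=
    (hΦ.contDiffOn hU).contDiffAt (hU.mem_nhds (hmem t ht))
  exact hsmooth.real_of_complex.congr_of_eventuallyEq
    (gegenbauerSeries_eventuallyEq_re hU (hmem t ht) h)

theorem hasSum_deriv_gegenbauerSeries (hlam : 0 ≤ lam) (hα : GeometricDecay α) {t : ℝ}
    (ht : |t| ≤ 1) :
    HasSum (fun l => α l * (derivative (gegenbauerPoly lam l)).eval t)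
      (deriv (gegenbauerSeries lam α) t) := by
  obtain ⟨U, hU, hmem, h⟩ := exists_tendstoLocallyUniformlyOn_complexGegenbauerSeries hlam hα
  have htU := hmem t ht
  have hΦ := differentiableOn_of_tendstoLocallyUniformlyOn_sum_mul_aeval hU h
  rw [(gegenbauerSeries_eventuallyEq_re hU htU h).deriv_eq,
    deriv_re_comp_ofReal (hΦ.differentiableAt (hU.mem_nhds htU))]
  exact hasSum_re_of_tendstoLocallyUniformlyOn_sum_mul_aeval htU
    (tendstoLocallyUniformlyOn_sum_mul_aeval_derivative hU h)

theorem hasSum_deriv_deriv_gegenbauerSeries (hlam : 0 ≤ lam) (hα : GeometricDecay α) {t : ℝ}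
    (ht : |t| ≤ 1) :
    HasSum (fun l => α l * (derivative (derivative (gegenbauerPoly lam l))).eval t)
      (deriv (deriv (gegenbauerSeries lam α)) t) := by
  obtain ⟨U, hU, hmem, h⟩ := exists_tendstoLocallyUniformlyOn_complexGegenbauerSeries hlam hα
  have htU := hmem t ht
  have h' := tendstoLocallyUniformlyOn_sum_mul_aeval_derivative hU h
  have hΦ := differentiableOn_of_tendstoLocallyUniformlyOn_sum_mul_aeval hU h
  have hderiv : deriv (gegenbauerSeries lam α) =ᶠ[𝓝 t]
      fun s : ℝ => (deriv (complexGegenbauerSeries lam α) s).re := by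
    filter_upwards [(gegenbauerSeries_eventuallyEq_re hU htU h).deriv,
      Complex.continuous_ofReal.continuousAt.eventually (hU.mem_nhds htU)] with s hs hsU
    rw [hs, deriv_re_comp_ofReal (hΦ.differentiableAt (hU.mem_nhds hsU))]
  rw [hderiv.deriv_eq,
    deriv_re_comp_ofReal ((hΦ.deriv hU).differentiableAt (hU.mem_nhds htU))]
  exact hasSum_re_of_tendstoLocallyUniformlyOn_sum_mul_aeval htU
    (tendstoLocallyUniformlyOn_sum_mul_aeval_derivative hU h')

/-- The zonal function on the sphere with Gegenbauer coefficients `α`. -/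
def zonalSeries (n : ℕ) (α : ℕ → ℝ) (x : Sph n) : ℝ :=
  gegenbauerSeries (order n) α ((x : Ambient n) 0)

theorem contMDiff_zonalSeries {n : ℕ} (hn : 2 ≤ n) (hα : GeometricDecay α) :
    ContMDiff (𝓡 n) 𝓘(ℝ, ℝ) ∞ (zonalSeries n α) := by
  have : Fact (Module.finrank ℝ (Ambient n) = n + 1) := ⟨by simp⟩
  intro x
  have hcoord : ContMDiff (𝓡 n) 𝓘(ℝ, ℝ) ∞ (fun x : Sph n => (x : Ambient n) 0) := by
    have hproj : ContDiff ℝ ∞ (fun y : Ambient n => y 0) := by fun_prop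
    exact hproj.contMDiff.comp (contMDiff_coe_sphere.of_le le_top)
  exact ContMDiffAt.comp x
    (contDiffAt_gegenbauerSeries (order_pos hn).le hα (abs_coord_le_one x 0)).contMDiffAt
    (hcoord x)

theorem continuous_zonalSeries {n : ℕ} (hn : 2 ≤ n) (hα : GeometricDecay α) :
    Continuous (zonalSeries n α) := (contMDiff_zonalSeries hn hα).continuous

theorem laplaceBeltrami_zonalSeries {n : ℕ} (hn : 2 ≤ n) (hα : GeometricDecay α) (x : Sph n) :
    laplaceBeltrami (zonalSeries n α) x =
      zonalSeries n (fun l => α l * -((l : ℝ) * (l + 2 * order n))) x := by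
  have hlam := (order_pos hn).le
  have hx := abs_coord_le_one x 0
  have hsmooth := contDiffAt_infty.mp (contDiffAt_gegenbauerSeries hlam hα hx) 2
  have hsum := ((hasSum_deriv_deriv_gegenbauerSeries hlam hα hx).mul_left
    (1 - (x : Ambient n) 0 ^ 2)).sub
      ((hasSum_deriv_gegenbauerSeries hlam hα hx).mul_left (n * (x : Ambient n) 0))
  refine (laplaceBeltrami_zonal x hsmooth).trans (hsum.tsum_eq.symm.trans (tsum_congr fun l => ?_))
  have hode := congrArg (eval ((x : Ambient n) 0)) (gegenbauerPoly_ode (order n) l)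
  rw [two_mul_order, sub_add_cancel] at hode
  simp only [eval_sub, eval_mul, eval_one, eval_pow, eval_X, eval_C, eval_neg] at hode
  rw [two_mul_order]
  linear_combination α l * hode

theorem hasSum_integral_zonalSeries_mul {n : ℕ} (hn : 2 ≤ n) (hα : GeometricDecay α)
    {g : Sph n → ℝ} (hg : Continuous g) :
    HasSum (fun l => α l * ∫ x : Sph n,
        (gegenbauerPoly (order n) l).eval ((x : Ambient n) 0) * g x ∂(surf n))
      (∫ x, zonalSeries n α x * g x ∂(surf n)) := by
  obtain ⟨u, hu, hle⟩ := exists_summable_bound_gegenbauerPoly (order_pos hn).le hα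
  have hint (l : ℕ) : Integrable (fun x : Sph n =>
      α l * (gegenbauerPoly (order n) l).eval ((x : Ambient n) 0) * g x) (surf n) :=
    integrable_of_continuous_sphere
      ((continuous_const.mul (continuous_eval_coord n _)).mul hg)
  have hnorm (l : ℕ) : ∫ x : Sph n, ‖α l * (gegenbauerPoly (order n) l).eval
      ((x : Ambient n) 0) * g x‖ ∂(surf n) ≤ u l * ∫ x, ‖g x‖ ∂(surf n) := by
    rw [← integral_const_mul]
    refine integral_mono (hint l).norm ((integrable_of_continuous_sphere hg.norm).const_mul _)
      fun x => ?_
    simp only [norm_mul _ (g x)]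
    exact mul_le_mul_of_nonneg_right (hle l _ (abs_coord_le_one x 0)) (norm_nonneg _)
  have hsum := hasSum_integral_of_summable_integral_norm hint (Summable.of_nonneg_of_le
    (fun l => integral_nonneg fun x => norm_nonneg _) hnorm (hu.mul_right _))
  simp only [mul_assoc, integral_const_mul] at hsum
  simpa only [zonalSeries, gegenbauerSeries, ← tsum_mul_right, mul_assoc] using hsum

theorem integral_gegenbauerPoly_mul_zonalSeries {n : ℕ} (hn : 2 ≤ n) (hα : GeometricDecay α)
    (m : ℕ) : ∫ x : Sph n, (gegenbauerPoly (order n) m).eval ((x : Ambient n) 0) *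
      zonalSeries n α x ∂(surf n) = α m * gegenbauerSqNorm n m := by
  have hsum := hasSum_integral_zonalSeries_mul hn hα
    (continuous_eval_coord n (gegenbauerPoly (order n) m))
  have hsingle := hasSum_single (f := fun l => α l * zonalIntegral n
    (gegenbauerPoly (order n) l * gegenbauerPoly (order n) m)) m fun l hl => by
      rw [zonalIntegral_gegenbauerPoly_mul_of_ne hn hl, mul_zero]
  simp only [zonalIntegral, LinearMap.coe_mk, AddHom.coe_mk, eval_mul] at hsingle
  simpa only [gegenbauerSqNorm, zonalIntegral, LinearMap.coe_mk, AddHom.coe_mk, eval_mul,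
    mul_comm] using hsum.unique hsingle

theorem hasSum_integral_zonalSeries_mul_zonalSeries {n : ℕ} (hn : 2 ≤ n) {β : ℕ → ℝ}
    (hα : GeometricDecay α) (hβ : GeometricDecay β) :
    HasSum (fun l => α l * (β l * gegenbauerSqNorm n l))
      (∫ x, zonalSeries n α x * zonalSeries n β x ∂(surf n)) := by
  simpa only [integral_gegenbauerPoly_mul_zonalSeries hn hβ] using
    hasSum_integral_zonalSeries_mul hn hα (continuous_zonalSeries hn hβ)

end ZonalSeries

section Quadratic

open Polynomial

/-- The weights `binom(l + n - 1, n - 1)`, up to a factor depending on `n` only, in terms of which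
the norm, the moment and the energy of a zonal function are expressed. -/
def zonalWeight (n l : ℕ) : ℝ := 2 * gegenbauerSqNorm n 0 * ((l + n - 1).choose (n - 1) : ℝ)

theorem zonalWeight_zero (n : ℕ) : zonalWeight n 0 = 2 * gegenbauerSqNorm n 0 := by
  simp [zonalWeight]

theorem zonalWeight_nonneg (n l : ℕ) : 0 ≤ zonalWeight n l := by
  have := gegenbauerSqNorm_zero_pos n
  rw [zonalWeight]; positivity

theorem zonalWeight_le {n l : ℕ} (hn : 1 ≤ n) (hl : 1 ≤ l) :
    zonalWeight n l ≤ 2 * gegenbauerSqNorm n 0 * n ^ (n - 1) * (l : ℝ) ^ (n - 1) := by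
  have hpos := gegenbauerSqNorm_zero_pos n
  have hle : l + n - 1 ≤ n * l := by
    obtain ⟨n, rfl⟩ := Nat.exists_eq_add_of_le' hn
    have : l + n ≤ n * l + l := by
      rw [add_comm]
      gcongr
      exact Nat.le_mul_of_pos_right n hl
    rwa [add_one_mul]
  have hchoose : (l + n - 1).choose (n - 1) ≤ (n * l) ^ (n - 1) :=
    (Nat.choose_le_pow _ _).trans (Nat.pow_le_pow_left hle _)
  rw [zonalWeight, mul_assoc (2 * gegenbauerSqNorm n 0), ← mul_pow]
  gcongr
  exact_mod_cast hchoose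

theorem le_zonalWeight {n : ℕ} (hn : 1 ≤ n) (l : ℕ) :
    2 * gegenbauerSqNorm n 0 / ((n - 1).factorial : ℝ) * (l : ℝ) ^ (n - 1) ≤ zonalWeight n l := by
  have hpos := gegenbauerSqNorm_zero_pos n
  have hchoose := Nat.pow_le_choose (n - 1) (l + n - 1) (α := ℝ)
  rw [show l + n - 1 + 1 - (n - 1) = l + 1 by omega] at hchoose
  rw [zonalWeight, div_mul_eq_mul_div, mul_div_assoc]
  refine mul_le_mul_of_nonneg_left (le_trans ?_ hchoose) (by positivity)
  gcongr
  exact l.le_succ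

theorem isBigO_zonalWeight {n : ℕ} (hn : 1 ≤ n) :
    zonalWeight n =O[atTop] fun l : ℕ => (l : ℝ) ^ (n - 1) := by
  refine IsBigO.of_bound (2 * gegenbauerSqNorm n 0 * n ^ (n - 1)) ?_
  filter_upwards [eventually_ge_atTop 1] with l hl
  rw [Real.norm_of_nonneg (zonalWeight_nonneg n l), Real.norm_of_nonneg (by positivity)]
  exact zonalWeight_le hn hl

theorem zonalWeight_eq {n : ℕ} (hn : 2 ≤ n) (l : ℕ) :
    order n ^ 2 * zonalWeight n l = (l + order n) * (l + 2 * order n) * gegenbauerSqNorm n l := by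
  rw [gegenbauerSqNorm_eq hn, zonalWeight]; ring

theorem zonalWeight_eq_succ {n : ℕ} (hn : 2 ≤ n) (l : ℕ) :
    order n ^ 2 * zonalWeight n l =
      (l + 1) * (l + 1 + order n) * gegenbauerSqNorm n (l + 1) := by
  rw [zonalWeight_eq hn, gegenbauerSqNorm_succ hn]

theorem gegenbauerSqNorm_nonneg (n l : ℕ) : 0 ≤ gegenbauerSqNorm n l := by
  simp only [gegenbauerSqNorm, zonalIntegral, LinearMap.coe_mk, AddHom.coe_mk, eval_mul]
  exact integral_nonneg fun x => mul_self_nonneg _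

variable {n : ℕ} {w : ℕ → ℝ}

/-- The coefficients `w_l (l + λ) / λ`, the form in which the sequence `w` enters the expansion of
the wavelet. -/
def scaledCoeff (n : ℕ) (w : ℕ → ℝ) (l : ℕ) : ℝ := w l * (((l : ℝ) + order n) / order n)

theorem order_mul_scaledCoeff (hn : 2 ≤ n) (w : ℕ → ℝ) (l : ℕ) :
    order n * scaledCoeff n w l = w l * (l + order n) := by
  have := order_pos hn
  rw [scaledCoeff]; field_simp

theorem GeometricDecay.scaledCoeff (hw : GeometricDecay w) (n : ℕ) :
    GeometricDecay (scaledCoeff n w) := by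
  refine hw.mul_of_isBigO_pow (m := 1) ?_
  simpa only [pow_one, div_eq_inv_mul] using
    (isBigO_natCast_add_const (order n)).const_mul_left (order n)⁻¹

theorem GeometricDecay.mul_zonalWeight (hn : 1 ≤ n) (hw : GeometricDecay w) :
    GeometricDecay fun l => w l * zonalWeight n l :=
  hw.mul_of_isBigO_pow (isBigO_zonalWeight hn)

theorem GeometricDecay.mul_energyFactor (hw : GeometricDecay w) (a : ℝ) :
    GeometricDecay fun l => w l * ((l : ℝ) * (l + a)) := by
  refine hw.mul_of_isBigO_pow (m := 2) ?_
  simpa only [sq] using (isBigO_refl _ _).mul (isBigO_natCast_add_const a)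

theorem hasSum_average_of_eq_add_shift {s r b : ℕ → ℝ} {S : ℝ} (hs : Summable s) (hr : Summable r)
    (hb : HasSum b S) (hzero : 2 * b 0 = s 0) (hsucc : ∀ l, 2 * b (l + 1) = s (l + 1) + r l) :
    HasSum (fun l => (s l + r l) / 2) S := by
  have htail : 2 * ∑' l, b (l + 1) = ∑' l, s (l + 1) + ∑' l, r l := by
    rw [← ((summable_nat_add_iff 1).mpr hs).tsum_add hr, ← tsum_mul_left]
    exact tsum_congr hsucc
  have hS : (∑' l, s l + ∑' l, r l) / 2 = S := by
    rw [← hb.tsum_eq, hb.summable.tsum_eq_zero_add, hs.tsum_eq_zero_add]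
    linarith
  exact hS ▸ (hs.hasSum.add hr.hasSum).div_const 2

theorem hasSum_integral_sq_zonalSeries (hn : 2 ≤ n) (hw : GeometricDecay w) :
    HasSum (fun l => zonalWeight n l * (w l ^ 2 + w (l + 1) ^ 2) / 2)
      (∫ x, |zonalSeries n (scaledCoeff n w) x| ^ 2 ∂(surf n)) := by
  have ho2 : order n ^ 2 ≠ 0 := pow_ne_zero 2 (order_pos hn).ne'
  have hα := hw.scaledCoeff n
  have hsum := hasSum_average_of_eq_add_shift
    ((hw.mul hw).mul_zonalWeight (n := n) (by omega)).summable
    ((hw.comp_succ.mul hw.comp_succ).mul_zonalWeight (n := n) (by omega)).summable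
    (hasSum_integral_zonalSeries_mul_zonalSeries hn hα hα) ?_ fun l => ?_
  · convert hsum using 2 with l
    · ring
    · funext x
      rw [sq_abs, sq]
  · refine mul_left_cancel₀ ho2 ?_
    have h0 := order_mul_scaledCoeff hn w 0
    rw [zonalWeight_zero]
    simp only [CharP.cast_eq_zero, zero_add] at h0
    linear_combination 2 * gegenbauerSqNorm n 0 *
      (order n * scaledCoeff n w 0 + w 0 * order n) * h0
  · refine mul_left_cancel₀ ho2 ?_
    have hl := order_mul_scaledCoeff hn w (l + 1)
    have hweight := zonalWeight_eq hn (l + 1)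
    have hweight' := zonalWeight_eq_succ hn l
    push_cast at hl hweight hweight'
    linear_combination 2 * gegenbauerSqNorm n (l + 1) *
      (order n * scaledCoeff n w (l + 1) + w (l + 1) * (l + 1 + order n)) * hl
      - w (l + 1) ^ 2 * (hweight + hweight')

theorem two_mul_order_mul_integral_coord_mul (f : Sph n → ℝ) :
    2 * order n * ∫ x : Sph n,
        (gegenbauerPoly (order n) 0).eval ((x : Ambient n) 0) * ((x : Ambient n) 0 * f x)
          ∂(surf n) =
      ∫ x : Sph n, (gegenbauerPoly (order n) 1).eval ((x : Ambient n) 0) * f x ∂(surf n) := by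
  rw [← integral_const_mul]
  refine integral_congr_ae (ae_of_all _ fun x => ?_)
  simp only [gegenbauerPoly, eval_one, eval_mul, eval_C, eval_X]
  ring

theorem integral_gegenbauerPoly_succ_mul_coord_mul {f : Sph n → ℝ} (hf : Continuous f) (l : ℕ) :
    2 * ((l : ℝ) + 1 + order n) * ∫ x : Sph n,
        (gegenbauerPoly (order n) (l + 1)).eval ((x : Ambient n) 0) * ((x : Ambient n) 0 * f x)
          ∂(surf n) =
      (l + 2) * ∫ x : Sph n,
        (gegenbauerPoly (order n) (l + 2)).eval ((x : Ambient n) 0) * f x ∂(surf n) +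
      (l + 2 * order n) * ∫ x : Sph n,
        (gegenbauerPoly (order n) l).eval ((x : Ambient n) 0) * f x ∂(surf n) := by
  have hint (l : ℕ) : Integrable (fun x : Sph n =>
      (gegenbauerPoly (order n) l).eval ((x : Ambient n) 0) * f x) (surf n) :=
    integrable_of_continuous_sphere ((continuous_eval_coord n _).mul hf)
  rw [← integral_const_mul, ← integral_const_mul, ← integral_const_mul,
    ← integral_add ((hint (l + 2)).const_mul _) ((hint l).const_mul _)]
  refine integral_congr_ae (ae_of_all _ fun x => ?_)
  have hrec := congrArg (eval ((x : Ambient n) 0)) (gegenbauerPoly_add_two (order n) l)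
  simp only [eval_mul, eval_C, eval_X, eval_sub] at hrec
  linear_combination -f x * hrec

theorem hasSum_integral_coord_mul_sq_zonalSeries (hn : 2 ≤ n) (hw : GeometricDecay w) :
    HasSum (fun l => zonalWeight n l * (w l * w (l + 1)))
      (∫ x : Sph n, |zonalSeries n (scaledCoeff n w) x| ^ 2 * (x : Ambient n) 0 ∂(surf n)) := by
  have ho2 : order n ^ 2 ≠ 0 := pow_ne_zero 2 (order_pos hn).ne'
  have hα := hw.scaledCoeff n
  set f := zonalSeries n (scaledCoeff n w) with hf
  have hfc : Continuous f := continuous_zonalSeries hn hα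
  have hcoeff := integral_gegenbauerPoly_mul_zonalSeries hn hα
  have hd := ((hw.mul hw.comp_succ).mul_zonalWeight (n := n) (by omega)).summable
  have hsum := hasSum_average_of_eq_add_shift hd hd (hasSum_integral_zonalSeries_mul hn hα
    (g := fun x => (x : Ambient n) 0 * f x) (by fun_prop)) ?_ fun l => ?_
  · convert hsum using 2 with l
    · ring
    · funext x
      rw [sq_abs]; ring
  · refine mul_left_cancel₀ ho2 ?_
    have hzero := two_mul_order_mul_integral_coord_mul f
    rw [hf, hcoeff 1, ← hf] at hzero
    have h0 := order_mul_scaledCoeff hn w 0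
    have h1 := order_mul_scaledCoeff hn w 1
    have hweight := zonalWeight_eq_succ hn 0
    simp only [CharP.cast_eq_zero, zero_add, Nat.cast_one] at h0 h1 hweight ⊢
    linear_combination 2 * order n * (∫ x : Sph n, (gegenbauerPoly (order n) 0).eval
        ((x : Ambient n) 0) * ((x : Ambient n) 0 * f x) ∂(surf n)) * h0 + w 0 * order n * hzero
      + w 0 * gegenbauerSqNorm n 1 * h1 - w 0 * w 1 * hweight
  · refine mul_left_cancel₀ ho2 ?_
    have hsucc := integral_gegenbauerPoly_succ_mul_coord_mul hfc l
    rw [hf, hcoeff (l + 2), hcoeff l, ← hf] at hsucc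
    have h0 := order_mul_scaledCoeff hn w l
    have h1 := order_mul_scaledCoeff hn w (l + 1)
    have h2 := order_mul_scaledCoeff hn w (l + 2)
    have hweight := zonalWeight_eq hn l
    have hweight' := zonalWeight_eq_succ hn (l + 1)
    push_cast at h0 h1 h2 hweight hweight'
    linear_combination 2 * order n * (∫ x : Sph n, (gegenbauerPoly (order n) (l + 1)).eval
        ((x : Ambient n) 0) * ((x : Ambient n) 0 * f x) ∂(surf n)) * h1
      + w (l + 1) * order n * hsucc + w (l + 1) * (l + 2) * gegenbauerSqNorm n (l + 2) * h2
      + w (l + 1) * (l + 2 * order n) * gegenbauerSqNorm n l * h0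
      - w (l + 1) * w (l + 2) * hweight' - w l * w (l + 1) * hweight

theorem hasSum_integral_sq_sub_coord_mul_sq_zonalSeries (hn : 2 ≤ n) (hw : GeometricDecay w) :
    HasSum (fun l => zonalWeight n l * (w l - w (l + 1)) ^ 2 / 2)
      (∫ x, |zonalSeries n (scaledCoeff n w) x| ^ 2 ∂(surf n) -
        ∫ x : Sph n, |zonalSeries n (scaledCoeff n w) x| ^ 2 * (x : Ambient n) 0 ∂(surf n)) := by
  refine ((hasSum_integral_sq_zonalSeries hn hw).sub
    (hasSum_integral_coord_mul_sq_zonalSeries hn hw)).congr_fun fun l => ?_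
  ring

theorem hasSum_neg_integral_laplaceBeltrami_mul_zonalSeries (hn : 2 ≤ n)
    (hw : GeometricDecay w) :
    HasSum (fun l : ℕ => (l : ℝ) * (l + 2 * order n) *
        (scaledCoeff n w l ^ 2 * gegenbauerSqNorm n l))
      (-∫ x, laplaceBeltrami (zonalSeries n (scaledCoeff n w)) x *
        zonalSeries n (scaledCoeff n w) x ∂(surf n)) := by
  have hα := hw.scaledCoeff n
  have hβ : GeometricDecay fun l => scaledCoeff n w l * -((l : ℝ) * (l + 2 * order n)) := by
    obtain ⟨θ, hθ, h⟩ := hα.mul_energyFactor (2 * order n)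
    exact ⟨θ, hθ, by simpa only [mul_neg] using h.neg_left⟩
  simp only [laplaceBeltrami_zonalSeries hn hα]
  refine (hasSum_integral_zonalSeries_mul_zonalSeries hn hβ hα).neg.congr_fun fun l => ?_
  ring

theorem neg_integral_laplaceBeltrami_mul_zonalSeries_nonneg (hn : 2 ≤ n)
    (hw : GeometricDecay w) :
    0 ≤ -∫ x, laplaceBeltrami (zonalSeries n (scaledCoeff n w)) x *
        zonalSeries n (scaledCoeff n w) x ∂(surf n) := by
  refine (hasSum_neg_integral_laplaceBeltrami_mul_zonalSeries hn hw).nonneg fun l => ?_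
  have := gegenbauerSqNorm_nonneg n l
  have := order_pos hn
  positivity

theorem scaledCoeff_sq_mul_gegenbauerSqNorm_le (hn : 2 ≤ n) (w : ℕ → ℝ) (l : ℕ) :
    scaledCoeff n w l ^ 2 * gegenbauerSqNorm n l ≤ w l ^ 2 * zonalWeight n l := by
  have ho := order_pos hn
  have hnorm := gegenbauerSqNorm_nonneg n l
  refine le_of_mul_le_mul_left ?_ (by positivity : 0 < order n ^ 2)
  calc order n ^ 2 * (scaledCoeff n w l ^ 2 * gegenbauerSqNorm n l)
      = w l ^ 2 * ((l + order n) * (l + order n) * gegenbauerSqNorm n l) := by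
        linear_combination gegenbauerSqNorm n l *
          (order n * scaledCoeff n w l + w l * (l + order n)) * order_mul_scaledCoeff hn w l
    _ ≤ w l ^ 2 * ((l + order n) * (l + 2 * order n) * gegenbauerSqNorm n l) := by
        gcongr; linarith
    _ = order n ^ 2 * (w l ^ 2 * zonalWeight n l) := by rw [← zonalWeight_eq hn]; ring

theorem GeometricDecay.summable_energy (hn : 1 ≤ n) (hw : GeometricDecay w) :
    Summable fun l : ℕ => (l : ℝ) * (l + 2 * order n) * (w l ^ 2 * zonalWeight n l) := by
  simpa only [sq, mul_comm] using
    (((hw.mul hw).mul_zonalWeight hn).mul_energyFactor (2 * order n)).summable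

theorem neg_integral_laplaceBeltrami_mul_zonalSeries_le (hn : 2 ≤ n) (hw : GeometricDecay w) :
    -∫ x, laplaceBeltrami (zonalSeries n (scaledCoeff n w)) x *
        zonalSeries n (scaledCoeff n w) x ∂(surf n) ≤
      ∑' l : ℕ, (l : ℝ) * (l + 2 * order n) * (w l ^ 2 * zonalWeight n l) := by
  have ho := order_pos hn
  refine hasSum_le (fun l => ?_) (hasSum_neg_integral_laplaceBeltrami_mul_zonalSeries hn hw)
    (hw.summable_energy (by omega)).hasSum
  exact mul_le_mul_of_nonneg_left (scaledCoeff_sq_mul_gegenbauerSqNorm_le hn w l) (by positivity)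

end Quadratic

section RiemannSums

variable {p δ : ℝ}

theorem hasDerivAt_div_one_add_rpow {x : ℝ} (hx : 0 < x) :
    HasDerivAt (fun t => (t / (1 + t)) ^ p) (p * (x ^ (p - 1) * (1 + x) ^ (-(p + 1)))) x := by
  have hx1 : 0 < 1 + x := by positivity
  have hdiv : HasDerivAt (fun t => t / (1 + t)) (1 / (1 + x) ^ 2) x := by
    refine ((hasDerivAt_id x).div ((hasDerivAt_id x).const_add 1) hx1.ne').congr_deriv ?_
    simp only [id]; ring
  refine (hdiv.rpow_const (Or.inl (by positivity))).congr_deriv ?_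
  have hpow : (1 + x) ^ (-(p + 1)) = ((1 + x) ^ (p - 1) * (1 + x) ^ 2)⁻¹ := by
    rw [Real.rpow_neg hx1.le, ← Real.rpow_add_natCast hx1.ne']
    ring_nf
  rw [Real.div_rpow hx.le hx1.le, hpow]
  field_simp

theorem continuousOn_div_one_add_rpow (hp : 0 < p) :
    ContinuousOn (fun t : ℝ => (t / (1 + t)) ^ p) (Set.Ici 0) := by
  refine (ContinuousOn.div (by fun_prop) (by fun_prop) fun t ht => ?_).rpow_const
    fun _ _ => Or.inr hp.le
  have : 0 ≤ t := ht
  positivity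

theorem mul_rpow_mul_one_add_rpow_le_sub (hp : 0 < p) (hp1 : p ≤ 1) (hδ : 0 < δ) {x : ℝ}
    (hx : 0 ≤ x) :
    p * (δ * ((x + δ) ^ (p - 1) * (1 + (x + δ)) ^ (-(p + 1)))) ≤
      ((x + δ) / (1 + (x + δ))) ^ p - (x / (1 + x)) ^ p := by
  obtain ⟨ξ, ⟨hxξ, hξx⟩, hξ⟩ := exists_hasDerivAt_eq_slope (fun t : ℝ => (t / (1 + t)) ^ p) _
    (lt_add_of_pos_right x hδ)
    ((continuousOn_div_one_add_rpow hp).mono fun t ht => hx.trans ht.1)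
    fun t ht => hasDerivAt_div_one_add_rpow (hx.trans_lt ht.1)
  have hξ0 : 0 < ξ := hx.trans_lt hxξ
  rw [eq_div_iff (by linarith), add_sub_cancel_left] at hξ
  calc p * (δ * ((x + δ) ^ (p - 1) * (1 + (x + δ)) ^ (-(p + 1))))
      ≤ p * (δ * (ξ ^ (p - 1) * (1 + ξ) ^ (-(p + 1)))) := by
        gcongr ?_ * (?_ * (?_ * ?_))
        · exact Real.rpow_le_rpow_of_nonpos hξ0 hξx.le (by linarith)
        · exact Real.rpow_le_rpow_of_nonpos (by linarith) (by linarith) (by linarith)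
    _ = _ := by rw [← hξ]; ring

theorem rpow_div_one_add_pow_le {r p x : ℝ} (hrp : r ≤ p) {N : ℕ} (hN : p + 1 ≤ N) (hx : 0 < x) :
    x ^ (p - 1) / (1 + x) ^ N ≤ x ^ (r - 1) * (1 + x) ^ (-(r + 1)) := by
  have hx1 : 1 ≤ 1 + x := by linarith
  rw [div_eq_mul_inv, ← Real.rpow_natCast, ← Real.rpow_neg (by positivity)]
  calc x ^ (p - 1) * (1 + x) ^ (-(N : ℝ))
      = x ^ (r - 1) * (x ^ (p - r) * (1 + x) ^ (-(N : ℝ))) := by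
        rw [← mul_assoc, ← Real.rpow_add hx]; ring_nf
    _ ≤ x ^ (r - 1) * ((1 + x) ^ (p - r) * (1 + x) ^ (-(N : ℝ))) := by
        have : 0 ≤ p - r := sub_nonneg.mpr hrp
        gcongr
        linarith
    _ ≤ x ^ (r - 1) * (1 + x) ^ (-(r + 1)) := by
        rw [← Real.rpow_add (by positivity)]
        gcongr
        linarith

-- A Riemann sum of the integrable function `x ^ (p - 1) / (1 + x) ^ N`, after comparison with the
-- monotone function `x ^ (r - 1) (1 + x) ^ (-(r + 1))`, `r = min 1 p`, whose sums telescope.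
theorem sum_range_mul_rpow_div_one_add_pow_le (hp : 0 < p) (hδ : 0 < δ) {N : ℕ}
    (hN : p + 1 ≤ N) (m : ℕ) :
    ∑ l ∈ Finset.range m, δ * ((δ * (l + 1 : ℕ)) ^ (p - 1) / (1 + δ * (l + 1 : ℕ)) ^ N) ≤
      1 / min 1 p := by
  have hr : 0 < min 1 p := lt_min one_pos hp
  set r := min 1 p
  set T : ℕ → ℝ := fun l => (δ * l / (1 + δ * l)) ^ r
  have hstep (l : ℕ) :
      r * (δ * ((δ * (l + 1 : ℕ)) ^ (p - 1) / (1 + δ * (l + 1 : ℕ)) ^ N)) ≤ T (l + 1) - T l := by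
    have hle := mul_rpow_mul_one_add_rpow_le_sub hr (min_le_left 1 p) hδ
      (by positivity : 0 ≤ δ * l)
    rw [show δ * (l : ℝ) + δ = δ * (l + 1 : ℕ) by push_cast; ring] at hle
    refine le_trans ?_ hle
    gcongr
    exact rpow_div_one_add_pow_le (min_le_right 1 p) hN (by positivity)
  have hT_nonneg : 0 ≤ T 0 := by positivity
  have hT_le : T m ≤ 1 := by
    refine Real.rpow_le_one (by positivity) ((div_le_one (by positivity)).mpr ?_) hr.le
    linarith
  rw [le_div_iff₀' hr, Finset.mul_sum]
  calc _ ≤ ∑ l ∈ Finset.range m, (T (l + 1) - T l) := Finset.sum_le_sum fun l _ => hstep l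
    _ = T m - T 0 := Finset.sum_range_sub T m
    _ ≤ 1 := by linarith

theorem hasSum_le_add_div_min {f : ℕ → ℝ} {S A : ℝ} (hp : 0 < p) (hδ : 0 < δ) {N : ℕ}
    (hN : p + 1 ≤ N) (hA : 0 ≤ A) (hf : HasSum f S)
    (hle : ∀ l : ℕ, 1 ≤ l → f l ≤ A * (δ * ((δ * l) ^ (p - 1) / (1 + δ * l) ^ N))) :
    S ≤ f 0 + A * (1 / min 1 p) := by
  refine le_of_tendsto' ((tendsto_add_atTop_iff_nat 1).mpr hf.tendsto_sum_nat) fun m => ?_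
  rw [Finset.sum_range_succ', add_comm]
  gcongr
  calc ∑ l ∈ Finset.range m, f (l + 1)
      ≤ ∑ l ∈ Finset.range m,
          A * (δ * ((δ * (l + 1 : ℕ)) ^ (p - 1) / (1 + δ * (l + 1 : ℕ)) ^ N)) :=
        Finset.sum_le_sum fun l _ => hle (l + 1) l.succ_pos
    _ ≤ A * (1 / min 1 p) := by
        rw [← Finset.mul_sum]
        gcongr
        exact sum_range_mul_rpow_div_one_add_pow_le hp hδ hN m

end RiemannSums

section ScaledSamples

/-- The sequence `w` resembles the samples `g (δ * l)` of a profile `g` which behaves like `s ^ β`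
at the origin and decays like `s ^ (-M)` at infinity; `K` is a constant independent of the
mesh `δ`. -/
structure IsScaledSample (K β : ℝ) (M : ℕ) (δ : ℝ) (w : ℕ → ℝ) : Prop where
  pos : 0 < δ
  le_one : δ ≤ 1
  abs_mul_le (l : ℕ) : |w l| * (1 + δ * l) ^ M ≤ K
  abs_sub_mul_le (l : ℕ) : 1 ≤ l →
    |w l - w (l + 1)| * (1 + δ * l) ^ M ≤ K * (δ * (δ * l) ^ (β - 1))
  one_le_mul_abs (l : ℕ) : 1 ≤ δ * l → δ * l ≤ 4 → 1 ≤ K * |w l|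

variable {n M : ℕ} {K β : ℝ}

theorem IsScaledSample.abs_le {δ : ℝ} {w : ℕ → ℝ} (h : IsScaledSample K β M δ w) (l : ℕ) :
    |w l| ≤ K := by
  have := h.pos
  refine le_trans (le_mul_of_one_le_right (abs_nonneg _) (one_le_pow₀ ?_)) (h.abs_mul_le l)
  linarith [(by positivity : 0 ≤ δ * l)]

theorem sq_le_div_pow_of_abs_mul_le {x y b : ℝ} (hy : 0 < y) (hxy : |x| * y ^ M ≤ b) :
    x ^ 2 ≤ b ^ 2 / y ^ (2 * M) := by
  rw [le_div_iff₀ (by positivity), ← sq_abs x, mul_comm 2 M, pow_mul, ← mul_pow]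
  gcongr

theorem IsScaledSample.pow_mul_variation_term_le {δ : ℝ} {w : ℕ → ℝ}
    (h : IsScaledSample K β M δ w) (hn : 2 ≤ n) {l : ℕ} (hl : 1 ≤ l) :
    δ ^ (n - 2) * (zonalWeight n l * (w l - w (l + 1)) ^ 2 / 2) ≤
      gegenbauerSqNorm n 0 * n ^ (n - 1) * K ^ 2 *
        (δ * ((δ * l) ^ ((n : ℝ) - 2 + 2 * β - 1) / (1 + δ * l) ^ (2 * M))) := by
  have hδ := h.pos
  have : (0 : ℝ) < l := by exact_mod_cast hl
  have hsq := sq_le_div_pow_of_abs_mul_le (by positivity) (h.abs_sub_mul_le l hl)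
  have hpow : (δ * l) ^ ((n : ℝ) - 2 + 2 * β - 1) =
      (δ * l) ^ (n - 1) * ((δ * l) ^ (β - 1)) ^ 2 := by
    rw [← Real.rpow_natCast, ← Real.rpow_mul_natCast (by positivity),
      ← Real.rpow_add (by positivity), Nat.cast_sub (by omega)]
    congr 1
    push_cast; ring
  have hδpow : δ ^ (n - 2) * δ ^ 2 = δ * δ ^ (n - 1) := by
    rw [← pow_add, ← pow_succ']; congr 1; omega
  calc δ ^ (n - 2) * (zonalWeight n l * (w l - w (l + 1)) ^ 2 / 2)
      ≤ δ ^ (n - 2) * (2 * gegenbauerSqNorm n 0 * n ^ (n - 1) * (l : ℝ) ^ (n - 1) *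
          ((K * (δ * (δ * l) ^ (β - 1))) ^ 2 / (1 + δ * l) ^ (2 * M)) / 2) := by
        have := gegenbauerSqNorm_zero_pos n
        gcongr
        exact zonalWeight_le (by omega) hl
    _ = gegenbauerSqNorm n 0 * n ^ (n - 1) * K ^ 2 * (δ ^ (n - 2) * δ ^ 2 * (l : ℝ) ^ (n - 1) *
          ((δ * l) ^ (β - 1)) ^ 2 / (1 + δ * l) ^ (2 * M)) := by ring
    _ = _ := by rw [hδpow, hpow, mul_pow]; ring

theorem exists_pow_mul_variation_le (hn : 2 ≤ n) (hβ : 0 < β)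
    (hM : (n : ℝ) - 1 + 2 * β ≤ 2 * M) (K : ℝ) :
    ∃ C : ℝ, 0 < C ∧ ∀ (δ : ℝ) (w : ℕ → ℝ) (S : ℝ), IsScaledSample K β M δ w →
      HasSum (fun l => zonalWeight n l * (w l - w (l + 1)) ^ 2 / 2) S → δ ^ (n - 2) * S ≤ C := by
  have hnorm := gegenbauerSqNorm_zero_pos n
  have hweight := zonalWeight_nonneg n 0
  have hn' : (2 : ℝ) ≤ n := by exact_mod_cast hn
  have hp : 0 < (n : ℝ) - 2 + 2 * β := by linarith
  refine ⟨zonalWeight n 0 * (2 * K) ^ 2 / 2 + gegenbauerSqNorm n 0 * n ^ (n - 1) * K ^ 2 *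
    (1 / min 1 ((n : ℝ) - 2 + 2 * β)) + 1, by positivity, fun δ w S h hS => ?_⟩
  have hδ := h.pos
  have hsum := hasSum_le_add_div_min hp hδ (N := 2 * M) (by push_cast; linarith) (by positivity)
    (hS.mul_left (δ ^ (n - 2))) fun l hl => h.pow_mul_variation_term_le hn hl
  have hjump : |w 0 - w 1| ≤ 2 * K := by
    linarith [abs_sub (w 0) (w 1), h.abs_le 0, h.abs_le 1]
  have hzero : δ ^ (n - 2) * (zonalWeight n 0 * (w 0 - w 1) ^ 2 / 2) ≤
      zonalWeight n 0 * (2 * K) ^ 2 / 2 := by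
    refine (mul_le_of_le_one_left (by positivity) (pow_le_one₀ hδ.le h.le_one)).trans ?_
    rw [← sq_abs]
    gcongr
  rw [zero_add] at hsum
  linarith

theorem IsScaledSample.pow_mul_energy_term_le {δ : ℝ} {w : ℕ → ℝ}
    (h : IsScaledSample K β M δ w) (hn : 1 ≤ n) {l : ℕ} (hl : 1 ≤ l) :
    δ ^ (n + 2) * ((l : ℝ) * (l + 2 * order n) * (w l ^ 2 * zonalWeight n l)) ≤
      n * (2 * gegenbauerSqNorm n 0 * n ^ (n - 1)) * K ^ 2 *
        (δ * ((δ * l) ^ ((n : ℝ) + 2 - 1) / (1 + δ * l) ^ (2 * M))) := by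
  have hδ := h.pos
  have hl1 : (1 : ℝ) ≤ l := by exact_mod_cast hl
  have hn1 : (1 : ℝ) ≤ n := by exact_mod_cast hn
  have hsq := sq_le_div_pow_of_abs_mul_le (by positivity) (h.abs_mul_le l)
  have hfactor : (l : ℝ) + 2 * order n ≤ n * l := by
    rw [two_mul_order]
    nlinarith
  have hpow : (δ * l) ^ ((n : ℝ) + 2 - 1) = (δ * l) ^ (n + 1) := by
    rw [← Real.rpow_natCast]
    congr 1
    push_cast; ring
  have hlpow : (l : ℝ) ^ (n + 1) = l ^ 2 * l ^ (n - 1) := by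
    rw [← pow_add]; congr 1; omega
  calc δ ^ (n + 2) * ((l : ℝ) * (l + 2 * order n) * (w l ^ 2 * zonalWeight n l))
      ≤ δ ^ (n + 2) * (l * (n * l) * (K ^ 2 / (1 + δ * l) ^ (2 * M) *
          (2 * gegenbauerSqNorm n 0 * n ^ (n - 1) * (l : ℝ) ^ (n - 1)))) := by
        have := zonalWeight_nonneg n l
        gcongr
        exact zonalWeight_le hn hl
    _ = _ := by rw [hpow, mul_pow, hlpow]; ring

theorem exists_pow_mul_energy_le (hn : 1 ≤ n) (hM : n + 3 ≤ 2 * M) (K β : ℝ) :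
    ∃ C : ℝ, 0 < C ∧ ∀ (δ : ℝ) (w : ℕ → ℝ) (S : ℝ), IsScaledSample K β M δ w →
      HasSum (fun l : ℕ => (l : ℝ) * (l + 2 * order n) * (w l ^ 2 * zonalWeight n l)) S →
      δ ^ (n + 2) * S ≤ C := by
  have hnorm := gegenbauerSqNorm_zero_pos n
  have hMn : (n : ℝ) + 2 + 1 ≤ (2 * M : ℕ) := by exact_mod_cast hM
  refine ⟨n * (2 * gegenbauerSqNorm n 0 * n ^ (n - 1)) * K ^ 2 * (1 / min 1 ((n : ℝ) + 2)) + 1,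
    by positivity, fun δ w S h hS => ?_⟩
  have hsum := hasSum_le_add_div_min (by positivity) h.pos hMn (by positivity)
    (hS.mul_left (δ ^ (n + 2))) fun l hl => h.pow_mul_energy_term_le hn hl
  simp only [CharP.cast_eq_zero, zero_mul, mul_zero, zero_add] at hsum
  linarith

theorem IsScaledSample.le_mass_term {δ : ℝ} {w : ℕ → ℝ} (h : IsScaledSample K β M δ w)
    (hn : 1 ≤ n) (hK : 0 < K) {N l : ℕ} (hN : 1 ≤ δ * N) (hNl : N ≤ l) (hl : δ * l ≤ 4) :
    2 * gegenbauerSqNorm n 0 / ((n - 1).factorial : ℝ) * (N : ℝ) ^ (n - 1) * (K⁻¹ ^ 2 / 2) ≤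
      zonalWeight n l * (w l ^ 2 + w (l + 1) ^ 2) / 2 := by
  have hδ := h.pos
  have hnorm := gegenbauerSqNorm_zero_pos n
  have hNl' : (N : ℝ) ≤ l := by exact_mod_cast hNl
  have hw : K⁻¹ ≤ |w l| :=
    (inv_le_iff_one_le_mul₀' hK).mpr (h.one_le_mul_abs l (hN.trans (by gcongr)) hl)
  have hw2 : K⁻¹ ^ 2 ≤ w l ^ 2 + w (l + 1) ^ 2 := by
    refine (pow_le_pow_left₀ (by positivity) hw 2).trans ?_
    rw [sq_abs]
    exact le_add_of_nonneg_right (sq_nonneg _)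
  have hweight : 2 * gegenbauerSqNorm n 0 / ((n - 1).factorial : ℝ) * (N : ℝ) ^ (n - 1) ≤
      zonalWeight n l := le_trans (by gcongr) (le_zonalWeight hn l)
  rw [mul_div_assoc (zonalWeight n l)]
  gcongr
  exact zonalWeight_nonneg n l

theorem exists_le_pow_mul_mass (hn : 1 ≤ n) (hK : 0 < K) :
    ∃ C : ℝ, 0 < C ∧ ∀ (δ : ℝ) (w : ℕ → ℝ) (S : ℝ), IsScaledSample K β M δ w →
      HasSum (fun l => zonalWeight n l * (w l ^ 2 + w (l + 1) ^ 2) / 2) S → C ≤ δ ^ n * S := by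
  have hnorm := gegenbauerSqNorm_zero_pos n
  set A := 2 * gegenbauerSqNorm n 0 / ((n - 1).factorial : ℝ)
  have : 0 < A := by positivity
  refine ⟨A * (K⁻¹ ^ 2 / 2), by positivity, fun δ w S h hS => ?_⟩
  have hδ := h.pos
  set N := ⌈1 / δ⌉₊
  have hδN : 1 ≤ δ * N := by rw [← div_le_iff₀' hδ]; exact Nat.le_ceil _
  have hδN2 : δ * N ≤ 2 := by
    have hN : (N : ℝ) < 1 / δ + 1 := Nat.ceil_lt_add_one (by positivity)
    rw [div_add_one hδ.ne', lt_div_iff₀' hδ] at hN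
    linarith [h.le_one]
  have hterm (l : ℕ) (hl : l ∈ Finset.Ico N (2 * N)) :
      A * (N : ℝ) ^ (n - 1) * (K⁻¹ ^ 2 / 2) ≤
        zonalWeight n l * (w l ^ 2 + w (l + 1) ^ 2) / 2 := by
    obtain ⟨hNl, hlN⟩ := Finset.mem_Ico.mp hl
    have hlN' : (l : ℝ) ≤ 2 * N := by exact_mod_cast hlN.le
    exact h.le_mass_term hn hK hδN hNl (by nlinarith)
  have hsum : N * (A * (N : ℝ) ^ (n - 1) * (K⁻¹ ^ 2 / 2)) ≤ S := by
    calc N * (A * (N : ℝ) ^ (n - 1) * (K⁻¹ ^ 2 / 2))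
        = ∑ _l ∈ Finset.Ico N (2 * N), A * (N : ℝ) ^ (n - 1) * (K⁻¹ ^ 2 / 2) := by
          rw [Finset.sum_const, Nat.card_Ico, nsmul_eq_mul, two_mul, Nat.add_sub_cancel]
      _ ≤ _ := Finset.sum_le_sum hterm
      _ ≤ S := sum_le_hasSum _ (fun l _ => by have := zonalWeight_nonneg n l; positivity) hS
  calc A * (K⁻¹ ^ 2 / 2) ≤ (δ * N) ^ n * (A * (K⁻¹ ^ 2 / 2)) :=
        le_mul_of_one_le_left (by positivity) (one_le_pow₀ hδN)
    _ = δ ^ n * (N * (A * (N : ℝ) ^ (n - 1) * (K⁻¹ ^ 2 / 2))) := by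
        rw [mul_pow, ← mul_pow_sub_one (by omega : n ≠ 0) (N : ℝ)]; ring
    _ ≤ δ ^ n * S := by gcongr

end ScaledSamples

section PolynomialBounds

open Polynomial

theorem exists_abs_eval_le_mul_pow (p : ℝ[X]) {d : ℕ} (hd : p.natDegree ≤ d) :
    ∃ C : ℝ, 0 < C ∧ ∀ x : ℝ, 1 ≤ x → |p.eval x| ≤ C * x ^ d := by
  refine ⟨∑ i ∈ Finset.range (p.natDegree + 1), |p.coeff i| + 1, by positivity, fun x hx => ?_⟩
  calc |p.eval x| ≤ ∑ i ∈ Finset.range (p.natDegree + 1), |p.coeff i * x ^ i| := by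
        rw [eval_eq_sum_range]; exact Finset.abs_sum_le_sum_abs _ _
    _ ≤ ∑ i ∈ Finset.range (p.natDegree + 1), |p.coeff i| * x ^ d := by
        refine Finset.sum_le_sum fun i hi => ?_
        have hi : i < p.natDegree + 1 := Finset.mem_range.mp hi
        rw [abs_mul, abs_of_nonneg (by positivity : 0 ≤ x ^ i)]
        gcongr
        omega
    _ ≤ _ := by
        rw [← Finset.sum_mul]
        gcongr
        exact (lt_add_one _).le

theorem exists_abs_eval_sub_eval_succ_le (p : ℝ[X]) :
    ∃ C : ℝ, 0 < C ∧ ∀ l : ℕ, 1 ≤ l →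
      |p.eval (l : ℝ) - p.eval ((l + 1 : ℕ) : ℝ)| ≤ C * (l : ℝ) ^ (p.natDegree - 1) := by
  obtain ⟨C, hC, hle⟩ := exists_abs_eval_le_mul_pow (derivative p) (natDegree_derivative_le p)
  refine ⟨C * 2 ^ (p.natDegree - 1), by positivity, fun l hl => ?_⟩
  have hl1 : (1 : ℝ) ≤ l := by exact_mod_cast hl
  obtain ⟨ξ, ⟨hlξ, hξl⟩, hξ⟩ := exists_hasDerivAt_eq_slope (fun x => p.eval x)
    (fun x => (derivative p).eval x) (lt_add_one (l : ℝ)) p.continuous.continuousOn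
    fun x _ => p.hasDerivAt x
  rw [add_sub_cancel_left, div_one] at hξ
  rw [abs_sub_comm, Nat.cast_succ, ← hξ, mul_assoc, ← mul_pow]
  refine (hle ξ (by linarith)).trans ?_
  gcongr <;> linarith

theorem exists_mul_pow_le_eval {p : ℝ[X]} (hpos : ∀ l : ℕ, 1 ≤ l → 0 < p.eval (l : ℝ)) :
    ∃ k : ℝ, 0 < k ∧ ∀ l : ℕ, 1 ≤ l → k * (l : ℝ) ^ p.natDegree ≤ p.eval (l : ℝ) := by
  have hp : p ≠ 0 := by
    rintro rfl
    simpa only [eval_zero, lt_self_iff_false] using hpos 1 le_rfl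
  have hlim : Tendsto (fun l : ℕ => (l : ℝ) ^ p.natDegree / p.eval (l : ℝ)) atTop
      (𝓝 (1 / p.leadingCoeff)) := by
    have h := div_tendsto_atTop_leadingCoeff_div_of_degree_eq (X ^ p.natDegree) p
      (by rw [degree_X_pow, degree_eq_natDegree hp])
    simp only [eval_pow, eval_X, leadingCoeff_X_pow] at h
    exact h.comp tendsto_natCast_atTop_atTop
  obtain ⟨C, hC⟩ := hlim.bddAbove_range
  have hle (l : ℕ) (hl : 1 ≤ l) : (l : ℝ) ^ p.natDegree ≤ C * p.eval (l : ℝ) :=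
    (div_le_iff₀ (hpos l hl)).mp (hC ⟨l, rfl⟩)
  have hC0 : 0 < C := by
    refine pos_of_mul_pos_left (lt_of_lt_of_le ?_ (hle 1 le_rfl)) (hpos 1 le_rfl).le
    positivity
  refine ⟨C⁻¹, inv_pos.mpr hC0, fun l hl => ?_⟩
  rw [inv_mul_le_iff₀ hC0]
  exact hle l hl

end PolynomialBounds

section Profile

/-- The function `y ^ c * exp (-y)` whose samples are the coefficients of the wavelets. -/
def profile (c y : ℝ) : ℝ := y ^ c * Real.exp (-y)

variable {c y : ℝ}

theorem profile_nonneg (hy : 0 ≤ y) : 0 ≤ profile c y :=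
  mul_nonneg (Real.rpow_nonneg hy c) (Real.exp_pos _).le

theorem one_add_pow_mul_exp_neg_le (hy : 0 ≤ y) (m : ℕ) :
    (1 + y) ^ m * Real.exp (-y) ≤ m.factorial * Real.exp 1 := by
  have h := Real.pow_div_factorial_le_exp (1 + y) (by positivity) m
  rw [div_le_iff₀' (by positivity), Real.exp_add, ← mul_assoc] at h
  rwa [Real.exp_neg, ← div_eq_mul_inv, div_le_iff₀ (Real.exp_pos y)]

theorem hasDerivAt_profile (hy : 0 < y) :
    HasDerivAt (profile c) (y ^ (c - 1) * ((c - y) * Real.exp (-y))) y := by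
  have h := (Real.hasDerivAt_rpow_const (p := c) (Or.inl hy.ne')).mul (hasDerivAt_neg y).exp
  refine h.congr_deriv ?_
  have hpow : y ^ c = y ^ (c - 1) * y := by
    rw [← Real.rpow_add_one hy.ne', sub_add_cancel]
  rw [hpow]
  ring

theorem one_add_pow_mul_abs_sub_mul_exp_neg_le (hc : 0 ≤ c) (hy : 0 ≤ y) (m : ℕ) :
    (1 + y) ^ m * (|c - y| * Real.exp (-y)) ≤ (1 + c) * ((m + 1).factorial * Real.exp 1) := by
  have habs : |c - y| ≤ (1 + c) * (1 + y) := by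
    rw [abs_le]; constructor <;> nlinarith
  calc (1 + y) ^ m * (|c - y| * Real.exp (-y))
      ≤ (1 + y) ^ m * ((1 + c) * (1 + y) * Real.exp (-y)) := by gcongr
    _ = (1 + c) * ((1 + y) ^ (m + 1) * Real.exp (-y)) := by ring
    _ ≤ _ := mul_le_mul_of_nonneg_left (one_add_pow_mul_exp_neg_le hy (m + 1)) (by positivity)

theorem one_add_pow_mul_profile_le (hc : 0 ≤ c) (hy : 0 ≤ y) (m : ℕ) :
    (1 + y) ^ m * profile c y ≤ (m + ⌈c⌉₊).factorial * Real.exp 1 := by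
  have hpow : y ^ c ≤ (1 + y) ^ ⌈c⌉₊ := by
    rw [← Real.rpow_natCast]
    exact (Real.rpow_le_rpow hy (by linarith) hc).trans
      (Real.rpow_le_rpow_of_exponent_le (by linarith) (Nat.le_ceil c))
  calc (1 + y) ^ m * profile c y ≤ (1 + y) ^ m * ((1 + y) ^ ⌈c⌉₊ * Real.exp (-y)) := by
        rw [profile]; gcongr
    _ = (1 + y) ^ (m + ⌈c⌉₊) * Real.exp (-y) := by rw [pow_add, mul_assoc]
    _ ≤ _ := one_add_pow_mul_exp_neg_le hy _

theorem profile_isBigO_exp_neg_half (c : ℝ) :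
    profile c =O[atTop] fun y => Real.exp (-(1 / 2 * y)) := by
  refine ((isLittleO_rpow_exp_pos_mul_atTop c one_half_pos).isBigO.mul
    (isBigO_refl (fun y => Real.exp (-y)) atTop)).congr_right fun y => ?_
  rw [← Real.exp_add]
  ring_nf

theorem geometricDecay_profile_comp {u : ℕ → ℝ} {k : ℝ} (hk : 0 < k)
    (hu : ∀ᶠ l : ℕ in atTop, k * l ≤ u l) : GeometricDecay fun l => profile c (u l) := by
  have htendsto : Tendsto u atTop atTop :=
    tendsto_atTop_mono' _ hu (tendsto_natCast_atTop_atTop.const_mul_atTop hk)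
  refine ⟨Real.exp (-(1 / 2 * k)), ⟨Real.exp_pos _, Real.exp_lt_one_iff.mpr (by linarith)⟩,
    ((profile_isBigO_exp_neg_half c).comp_tendsto htendsto).trans (IsBigO.of_bound' ?_)⟩
  filter_upwards [hu] with l hl
  rw [Function.comp_apply, Real.norm_of_nonneg (Real.exp_pos _).le,
    Real.norm_of_nonneg (by positivity), ← Real.exp_nat_mul, Real.exp_le_exp]
  linarith

variable {k₁ k₂ : ℝ} {ν : ℕ}

theorem one_add_le_mul_one_add {s : ℝ} (hk₁ : 0 < k₁) (hν : ν ≠ 0) (hs : 0 ≤ s)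
    (hy : k₁ * s ^ ν ≤ y) : 1 + s ≤ (2 + k₁⁻¹) * (1 + y) := by
  have hpow : s ≤ 1 + s ^ ν := by
    rcases le_total s 1 with h | h
    · exact h.trans (le_add_of_nonneg_right (by positivity))
    · linarith [le_self_pow₀ h hν]
  have hdiv : s ^ ν ≤ k₁⁻¹ * y := (le_inv_mul_iff₀ hk₁).mpr hy
  have hk : 0 < k₁⁻¹ := inv_pos.mpr hk₁
  have hy0 : 0 ≤ y := le_trans (by positivity) hy
  nlinarith

theorem rpow_le_mul_rpow_of_mem_Icc {t : ℝ} (hk₁ : 0 < k₁) (ht : 0 < t)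
    (hy : y ∈ Set.Icc (k₁ * t) (k₂ * t)) (r : ℝ) : y ^ r ≤ (k₁ ^ r + k₂ ^ r) * t ^ r := by
  have hy0 : 0 < y := lt_of_lt_of_le (by positivity) hy.1
  have hk₂ : 0 < k₂ := pos_of_mul_pos_left (hy0.trans_le hy.2) ht.le
  rw [add_mul, ← Real.mul_rpow hk₁.le ht.le, ← Real.mul_rpow hk₂.le ht.le]
  rcases le_total 0 r with hr | hr
  · exact (Real.rpow_le_rpow hy0.le hy.2 hr).trans (le_add_of_nonneg_left (by positivity))
  · exact (Real.rpow_le_rpow_of_nonpos (by positivity) hy.1 hr).trans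
      (le_add_of_nonneg_right (by positivity))

theorem exists_profile_mul_one_add_pow_le (hc : 0 ≤ c) (hk₁ : 0 < k₁) (hν : ν ≠ 0) (M : ℕ) :
    ∃ B : ℝ, 0 < B ∧ ∀ s y : ℝ, 0 ≤ s → k₁ * s ^ ν ≤ y → profile c y * (1 + s) ^ M ≤ B := by
  refine ⟨(2 + k₁⁻¹) ^ M * ((M + ⌈c⌉₊).factorial * Real.exp 1), by positivity,
    fun s y hs hy => ?_⟩
  have hy0 : 0 ≤ y := le_trans (by positivity) hy
  calc profile c y * (1 + s) ^ M ≤ profile c y * ((2 + k₁⁻¹) * (1 + y)) ^ M := by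
        have := profile_nonneg (c := c) hy0
        gcongr
        exact one_add_le_mul_one_add hk₁ hν hs hy
    _ = (2 + k₁⁻¹) ^ M * ((1 + y) ^ M * profile c y) := by rw [mul_pow]; ring
    _ ≤ _ := mul_le_mul_of_nonneg_left (one_add_pow_mul_profile_le hc hy0 M) (by positivity)

theorem exists_abs_profile_sub_mul_one_add_pow_le (hc : 0 ≤ c) (hk₁ : 0 < k₁) (hk₂ : 0 < k₂)
    (hν : ν ≠ 0) (M : ℕ) :
    ∃ B : ℝ, 0 < B ∧ ∀ s y z : ℝ, 0 < s → y ∈ Set.Icc (k₁ * s ^ ν) (k₂ * s ^ ν) →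
      z ∈ Set.Icc (k₁ * s ^ ν) (k₂ * s ^ ν) →
      |profile c y - profile c z| * (1 + s) ^ M ≤ B * ((s ^ ν) ^ (c - 1) * |y - z|) := by
  set A := k₁ ^ (c - 1) + k₂ ^ (c - 1)
  set B := (2 + k₁⁻¹) ^ M * ((1 + c) * ((M + 1).factorial * Real.exp 1))
  refine ⟨A * B, by positivity, fun s y z hs hy hz => ?_⟩
  have hderiv (ξ : ℝ) (hξ : ξ ∈ Set.Icc (k₁ * s ^ ν) (k₂ * s ^ ν)) :
      ‖ξ ^ (c - 1) * ((c - ξ) * Real.exp (-ξ))‖ ≤ A * (s ^ ν) ^ (c - 1) * (B / (1 + s) ^ M) := by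
    have hξ0 : 0 < ξ := lt_of_lt_of_le (by positivity) hξ.1
    rw [norm_mul, norm_mul, Real.norm_of_nonneg (by positivity), Real.norm_eq_abs,
      Real.norm_of_nonneg (Real.exp_pos _).le]
    gcongr
    · exact rpow_le_mul_rpow_of_mem_Icc hk₁ (by positivity) hξ _
    · rw [le_div_iff₀ (by positivity)]
      calc |c - ξ| * Real.exp (-ξ) * (1 + s) ^ M
          ≤ |c - ξ| * Real.exp (-ξ) * ((2 + k₁⁻¹) * (1 + ξ)) ^ M := by
            gcongr
            exact one_add_le_mul_one_add hk₁ hν hs.le hξ.1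
        _ = (2 + k₁⁻¹) ^ M * ((1 + ξ) ^ M * (|c - ξ| * Real.exp (-ξ))) := by
            rw [mul_pow]; ring
        _ ≤ B := mul_le_mul_of_nonneg_left
            (one_add_pow_mul_abs_sub_mul_exp_neg_le hc hξ0.le M) (by positivity)
  have hmvt := (convex_Icc (k₁ * s ^ ν) (k₂ * s ^ ν)).norm_image_sub_le_of_norm_hasDerivWithin_le
    (fun ξ hξ => (hasDerivAt_profile (lt_of_lt_of_le (by positivity) hξ.1)).hasDerivWithinAt)
    hderiv hz hy
  rw [Real.norm_eq_abs, Real.norm_eq_abs] at hmvt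
  calc |profile c y - profile c z| * (1 + s) ^ M
      ≤ A * (s ^ ν) ^ (c - 1) * (B / (1 + s) ^ M) * |y - z| * (1 + s) ^ M := by gcongr
    _ = A * B * ((s ^ ν) ^ (c - 1) * |y - z|) := by field_simp

/-- The points `u l` are comparable with `(δ * l) ^ ν` for `l ≥ 1`, and so are their increments
with the derivative of this power. -/
structure IsPowerMesh (k₁ k₂ k₃ : ℝ) (ν : ℕ) (δ : ℝ) (u : ℕ → ℝ) : Prop where
  pos : 0 < δ
  le_one : δ ≤ 1
  le (l : ℕ) : 1 ≤ l → k₁ * (δ * l) ^ ν ≤ u l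
  ge (l : ℕ) : 1 ≤ l → u l ≤ k₂ * (δ * l) ^ ν
  abs_sub_le (l : ℕ) : 1 ≤ l → |u l - u (l + 1)| ≤ k₃ * (δ * (δ * l) ^ (ν - 1))

theorem IsPowerMesh.mem_Icc_succ {k₃ δ : ℝ} {u : ℕ → ℝ} (h : IsPowerMesh k₁ k₂ k₃ ν δ u)
    (hk₁ : 0 ≤ k₁) (hk₃ : 0 ≤ k₃) (hν : ν ≠ 0) {l : ℕ} (hl : 1 ≤ l) :
    u (l + 1) ∈ Set.Icc (k₁ * (δ * l) ^ ν) ((k₂ + k₃) * (δ * l) ^ ν) := by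
  have hδ := h.pos
  have hl1 : (1 : ℝ) ≤ l := by exact_mod_cast hl
  constructor
  · refine le_trans ?_ (h.le (l + 1) (by omega))
    gcongr
    exact l.le_succ
  · have hincr : k₃ * (δ * (δ * l) ^ (ν - 1)) ≤ k₃ * (δ * l) ^ ν := by
      rw [← mul_pow_sub_one hν (δ * (l : ℝ))]
      gcongr
      exact le_mul_of_one_le_right hδ.le hl1
    have := neg_abs_le (u l - u (l + 1))
    linarith [h.ge l hl, h.abs_sub_le l hl]

theorem exists_abs_profile_sub_mul_le_of_isPowerMesh {k₃ : ℝ} (hc : 0 ≤ c) (hk₁ : 0 < k₁)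
    (hk₂ : 0 < k₂) (hk₃ : 0 < k₃) (hν : ν ≠ 0) (M : ℕ) :
    ∃ B : ℝ, 0 < B ∧ ∀ (δ : ℝ) (u : ℕ → ℝ), IsPowerMesh k₁ k₂ k₃ ν δ u → ∀ l : ℕ, 1 ≤ l →
      |profile c (u l) - profile c (u (l + 1))| * (1 + δ * l) ^ M ≤
        B * (δ * (δ * l) ^ (ν * c - 1)) := by
  obtain ⟨B, hB, hvar⟩ := exists_abs_profile_sub_mul_one_add_pow_le hc hk₁
    (by positivity : 0 < k₂ + k₃) hν M
  refine ⟨B * k₃, by positivity, fun δ u h l hl => ?_⟩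
  have hδ := h.pos
  have hs : 0 < δ * l := by positivity
  have hmem : u l ∈ Set.Icc (k₁ * (δ * l) ^ ν) ((k₂ + k₃) * (δ * l) ^ ν) :=
    ⟨h.le l hl, (h.ge l hl).trans (by gcongr; linarith)⟩
  have hpow : ((δ * l) ^ ν) ^ (c - 1) * (δ * l) ^ (ν - 1) = (δ * l) ^ ((ν : ℝ) * c - 1) := by
    rw [← Real.rpow_natCast, ← Real.rpow_natCast, ← Real.rpow_mul hs.le, ← Real.rpow_add hs,
      Nat.cast_sub (by omega)]
    congr 1
    push_cast
    ring
  calc |profile c (u l) - profile c (u (l + 1))| * (1 + δ * l) ^ M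
      ≤ B * (((δ * l) ^ ν) ^ (c - 1) * |u l - u (l + 1)|) :=
        hvar _ _ _ hs hmem (h.mem_Icc_succ hk₁.le hk₃.le hν hl)
    _ ≤ B * (((δ * l) ^ ν) ^ (c - 1) * (k₃ * (δ * (δ * l) ^ (ν - 1)))) := by
        gcongr
        exact h.abs_sub_le l hl
    _ = B * k₃ * (δ * (δ * l) ^ ((ν : ℝ) * c - 1)) := by rw [← hpow]; ring

theorem IsPowerMesh.le_profile {k₃ δ : ℝ} {u : ℕ → ℝ} (h : IsPowerMesh k₁ k₂ k₃ ν δ u)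
    (hc : 0 ≤ c) (hk₁ : 0 < k₁) (hk₂ : 0 < k₂) {l : ℕ} (hl : 1 ≤ δ * l) (hl4 : δ * l ≤ 4) :
    k₁ ^ c * Real.exp (-(k₂ * 4 ^ ν)) ≤ profile c (u l) := by
  have hl1 : 1 ≤ l := by
    rw [Nat.one_le_iff_ne_zero]
    rintro rfl
    norm_num at hl
  have hlow : k₁ ≤ u l := (le_mul_of_one_le_right hk₁.le (one_le_pow₀ hl)).trans (h.le l hl1)
  have hupp : u l ≤ k₂ * 4 ^ ν := (h.ge l hl1).trans (by gcongr)
  rw [profile]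
  gcongr
  exact Real.rpow_nonneg (hk₁.le.trans hlow) c

theorem exists_isScaledSample_profile {k₃ : ℝ} (hc : 0 ≤ c) (hk₁ : 0 < k₁) (hk₂ : 0 < k₂)
    (hk₃ : 0 < k₃) (hν : ν ≠ 0) (M : ℕ) (W : ℝ) :
    ∃ K : ℝ, 0 < K ∧ ∀ (δ : ℝ) (u : ℕ → ℝ), IsPowerMesh k₁ k₂ k₃ ν δ u → |profile c (u 0)| ≤ W →
      IsScaledSample K (ν * c) M δ fun l => profile c (u l) := by
  obtain ⟨B₁, hB₁, hdecay⟩ := exists_profile_mul_one_add_pow_le hc hk₁ hν M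
  obtain ⟨B₂, hB₂, hvar⟩ := exists_abs_profile_sub_mul_le_of_isPowerMesh hc hk₁ hk₂ hk₃ hν M
  set b := k₁ ^ c * Real.exp (-(k₂ * 4 ^ ν))
  have hb : 0 < b := by positivity
  have hb' : 0 < b⁻¹ := inv_pos.mpr hb
  have hWabs := le_abs_self W
  have hW0 := abs_nonneg W
  refine ⟨|W| + B₁ + B₂ + b⁻¹, by positivity, fun δ u h hW => ?_⟩
  have hδ := h.pos
  refine ⟨hδ, h.le_one, fun l => ?_, fun l hl => ?_, fun l hl hl4 => ?_⟩
  · rcases Nat.eq_zero_or_pos l with rfl | hl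
    · rw [Nat.cast_zero, mul_zero, add_zero, one_pow, mul_one]
      linarith
    · have hu : 0 ≤ u l := le_trans (by positivity) (h.le l hl)
      rw [abs_of_nonneg (profile_nonneg hu)]
      linarith [hdecay (δ * l) (u l) (by positivity) (h.le l hl)]
  · refine (hvar δ u h l hl).trans ?_
    gcongr
    linarith
  · calc (1 : ℝ) = b⁻¹ * b := (inv_mul_cancel₀ hb.ne').symm
      _ ≤ (|W| + B₁ + B₂ + b⁻¹) * |profile c (u l)| := by
          gcongr
          · linarith
          · exact (h.le_profile hc hk₁ hk₂ hl hl4).trans (le_abs_self _)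

end Profile

section Variance

variable {n : ℕ} {f : Sph n → ℝ}

theorem integral_sq_mul_coord_le_norm_firstMoment (hf : Continuous f) :
    ∫ x : Sph n, |f x| ^ 2 * (x : Ambient n) 0 ∂(surf n) ≤ ‖firstMoment f‖ := by
  have hint : Integrable (fun x : Sph n => |f x| ^ 2 • (x : Ambient n)) (surf n) :=
    integrable_of_continuous_sphere ((hf.abs.pow 2).smul continuous_subtype_val)
  calc ∫ x : Sph n, |f x| ^ 2 * (x : Ambient n) 0 ∂(surf n) = firstMoment f 0 :=
        (EuclideanSpace.proj (𝕜 := ℝ) (0 : Fin (n + 1))).integral_comp_comm hint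
    _ ≤ ‖firstMoment f‖ := (le_abs_self _).trans (PiLp.norm_apply_le (firstMoment f) 0)

theorem norm_firstMoment_le (f : Sph n → ℝ) :
    ‖firstMoment f‖ ≤ ∫ x, |f x| ^ 2 ∂(surf n) := by
  refine (norm_integral_le_integral_norm _).trans_eq (integral_congr_ae (ae_of_all _ fun x => ?_))
  simp only [norm_smul, norm_eq_of_mem_sphere x, mul_one]
  exact Real.norm_of_nonneg (by positivity)

theorem varS_nonneg (hf : firstMoment f ≠ 0) : 0 ≤ varS f := by
  rw [varS, sub_nonneg]
  exact one_le_pow₀ ((one_le_div (norm_pos_iff.mpr hf)).mpr (norm_firstMoment_le f))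

theorem varS_le {ε : ℝ} (hε0 : 0 ≤ ε) (hε : ε ≤ 1 / 2) (hf : firstMoment f ≠ 0)
    (hle : (1 - ε) * ∫ x, |f x| ^ 2 ∂(surf n) ≤ ‖firstMoment f‖) : varS f ≤ 8 * ε := by
  have hm : 0 < ‖firstMoment f‖ := norm_pos_iff.mpr hf
  rw [varS]
  set I := ∫ x, |f x| ^ 2 ∂(surf n)
  have hI : 0 ≤ I := integral_nonneg fun x => by positivity
  have hratio : I / ‖firstMoment f‖ ≤ 1 + 2 * ε := by
    rw [div_le_iff₀ hm]
    calc I ≤ (1 + 2 * ε) * (1 - ε) * I := le_mul_of_one_le_left hI (by nlinarith)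
      _ = (1 + 2 * ε) * ((1 - ε) * I) := by ring
      _ ≤ _ := by gcongr
  calc (I / ‖firstMoment f‖) ^ 2 - 1 ≤ (1 + 2 * ε) ^ 2 - 1 := by gcongr
    _ ≤ 8 * ε := by nlinarith

end Variance

section ScaledZonalSeries

theorem le_div_mul_of_mul_le {t C₀ C₁ A B : ℝ} (ht : 0 < t) (hC₀ : 0 < C₀) (hC₁ : 0 ≤ C₁)
    (hA : t * A ≤ C₁) (hB : C₀ ≤ t * B) : A ≤ C₁ / C₀ * B := by
  refine le_of_mul_le_mul_left ?_ ht
  calc t * A ≤ C₁ / C₀ * C₀ := by rwa [div_mul_cancel₀ _ hC₀.ne']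
    _ ≤ C₁ / C₀ * (t * B) := by gcongr
    _ = t * (C₁ / C₀ * B) := by ring

variable {n M : ℕ} {K β : ℝ}

theorem exists_integral_zonalSeries_bounds (hn : 2 ≤ n) (hβ : 0 < β)
    (hM : (n : ℝ) - 1 + 2 * β ≤ 2 * M) (hM' : n + 3 ≤ 2 * M) (hK : 0 < K) :
    ∃ C : ℝ, 0 < C ∧ ∀ (δ : ℝ) (w : ℕ → ℝ), GeometricDecay w → IsScaledSample K β M δ w →
      let f := zonalSeries n (scaledCoeff n w)
      0 < ∫ x, |f x| ^ 2 ∂(surf n) ∧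
      ∫ x, |f x| ^ 2 ∂(surf n) - ∫ x : Sph n, |f x| ^ 2 * (x : Ambient n) 0 ∂(surf n) ≤
        C * (δ ^ 2 * ∫ x, |f x| ^ 2 ∂(surf n)) ∧
      δ ^ 2 * -∫ x, laplaceBeltrami f x * f x ∂(surf n) ≤ C * ∫ x, |f x| ^ 2 ∂(surf n) := by
  obtain ⟨C₁, hC₁, hvar⟩ := exists_pow_mul_variation_le hn hβ hM K
  obtain ⟨C₂, hC₂, henergy⟩ := exists_pow_mul_energy_le (by omega) hM' K β
  obtain ⟨C₀, hC₀, hmass⟩ := exists_le_pow_mul_mass (n := n) (M := M) (β := β) (by omega) hK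
  refine ⟨max (C₁ / C₀) (C₂ / C₀), lt_max_of_lt_left (by positivity), fun δ w hw h => ?_⟩
  intro f
  have hδ := h.pos
  have h0 := hmass δ w _ h (hasSum_integral_sq_zonalSeries hn hw)
  have h1 := hvar δ w _ h (hasSum_integral_sq_sub_coord_mul_sq_zonalSeries hn hw)
  have h2 := henergy δ w _ h (hw.summable_energy (by omega)).hasSum
  have hI : 0 < ∫ x, |f x| ^ 2 ∂(surf n) :=
    pos_of_mul_pos_right (hC₀.trans_le h0) (by positivity)
  refine ⟨hI, ?_, ?_⟩
  · refine (le_div_mul_of_mul_le (by positivity) hC₀ hC₁.le h1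
      (B := δ ^ 2 * ∫ x, |f x| ^ 2 ∂(surf n)) ?_).trans ?_
    · rwa [← mul_assoc, ← pow_add, Nat.sub_add_cancel hn]
    · gcongr
      exact le_max_left _ _
  · rw [pow_add, mul_assoc] at h2
    have hle := neg_integral_laplaceBeltrami_mul_zonalSeries_le hn hw
    calc δ ^ 2 * -∫ x, laplaceBeltrami f x * f x ∂(surf n)
        ≤ δ ^ 2 * ∑' l : ℕ, (l : ℝ) * (l + 2 * order n) * (w l ^ 2 * zonalWeight n l) := by
          gcongr
      _ ≤ C₂ / C₀ * ∫ x, |f x| ^ 2 ∂(surf n) :=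
          le_div_mul_of_mul_le (by positivity) hC₀ hC₂.le h2 h0
      _ ≤ _ := by
          gcongr
          exact le_max_right _ _

theorem exists_variance_zonalSeries_bounds (hn : 2 ≤ n) (hβ : 0 < β)
    (hM : (n : ℝ) - 1 + 2 * β ≤ 2 * M) (hM' : n + 3 ≤ 2 * M) (hK : 0 < K) :
    ∃ C : ℝ, 0 < C ∧ ∀ (δ : ℝ) (w : ℕ → ℝ), GeometricDecay w → IsScaledSample K β M δ w →
      C * δ ^ 2 ≤ 1 →
      let f := zonalSeries n (scaledCoeff n w)
      firstMoment f ≠ 0 ∧ varS f ∈ Set.Icc 0 (C * δ ^ 2) ∧ varM f ∈ Set.Icc 0 (C / δ ^ 2) := by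
  obtain ⟨C, hC, hbound⟩ := exists_integral_zonalSeries_bounds hn hβ hM hM' hK
  refine ⟨8 * C, by positivity, fun δ w hw h hsmall => ?_⟩
  intro f
  have hδ := h.pos
  obtain ⟨hI, hdefect, henergy⟩ := hbound δ w hw h
  have hlow : (1 - C * δ ^ 2) * ∫ x, |f x| ^ 2 ∂(surf n) ≤ ‖firstMoment f‖ := by
    refine le_trans ?_ (integral_sq_mul_coord_le_norm_firstMoment
      (continuous_zonalSeries hn (hw.scaledCoeff n)))
    linarith
  have hm : firstMoment f ≠ 0 :=
    norm_pos_iff.mp ((mul_pos (by linarith) hI).trans_le hlow)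
  refine ⟨hm, ⟨varS_nonneg hm, ?_⟩, ?_, ?_⟩
  · linarith [varS_le (by positivity) (by linarith) hm hlow]
  · rw [varM, ← neg_div]
    exact div_nonneg (neg_integral_laplaceBeltrami_mul_zonalSeries_nonneg hn hw) hI.le
  · rw [varM, ← neg_div, div_le_div_iff₀ hI (by positivity), mul_comm]
    refine henergy.trans ?_
    gcongr
    linarith

end ScaledZonalSeries

section Wavelet

variable {a c ρ : ℝ} {q : Polynomial ℝ}

/-- The coefficients of the wavelet with respect to the kernels `(l + λ) / λ * C_l^λ`. -/
def waveletSeq (a c : ℝ) (q : Polynomial ℝ) (ρ : ℝ) (l : ℕ) : ℝ :=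
  profile c (ρ ^ a * q.eval (l : ℝ))

theorem waveletTerm_eq (n : ℕ) (a c : ℝ) (q : Polynomial ℝ) (ρ : ℝ) (x : Sph n) (l : ℕ) :
    waveletTerm n a c q ρ x l = scaledCoeff n (waveletSeq a c q ρ) l *
      (gegenbauerPoly (order n) l).eval ((x : Ambient n) 0) := by
  rw [waveletTerm, gegenbauer_eq_eval_gegenbauerPoly]; rfl

theorem wavelet_eq (n : ℕ) (a c : ℝ) (q : Polynomial ℝ) (ρ : ℝ) :
    wavelet n a c q ρ = zonalSeries n (scaledCoeff n (waveletSeq a c q ρ)) := by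
  funext x
  simp only [wavelet, zonalSeries, gegenbauerSeries, waveletTerm_eq]

theorem geometricDecay_waveletSeq (a c : ℝ) (hdeg : q.natDegree ≠ 0)
    (hpos : ∀ l : ℕ, 1 ≤ l → 0 < q.eval (l : ℝ)) (hρ : 0 < ρ) :
    GeometricDecay (waveletSeq a c q ρ) := by
  obtain ⟨k, hk, hle⟩ := exists_mul_pow_le_eval hpos
  refine geometricDecay_profile_comp (mul_pos (Real.rpow_pos_of_pos hρ a) hk) ?_
  filter_upwards [eventually_ge_atTop 1] with l hl
  rw [mul_assoc]
  gcongr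
  refine le_trans ?_ (hle l hl)
  gcongr
  exact le_self_pow₀ (by exact_mod_cast hl) hdeg

theorem summable_waveletTerm {n : ℕ} (hn : 2 ≤ n) (a c : ℝ) (hdeg : q.natDegree ≠ 0)
    (hpos : ∀ l : ℕ, 1 ≤ l → 0 < q.eval (l : ℝ)) (hρ : 0 < ρ) (x : Sph n) :
    Summable (waveletTerm n a c q ρ x) :=
  (hasSum_gegenbauerSeries (order_pos hn).le
    ((geometricDecay_waveletSeq a c hdeg hpos hρ).scaledCoeff n)
    (abs_coord_le_one x 0)).summable.congr fun l =>
      (waveletTerm_eq n a c q ρ x l).symm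

theorem contMDiff_wavelet {n : ℕ} (hn : 2 ≤ n) (a c : ℝ) (hdeg : q.natDegree ≠ 0)
    (hpos : ∀ l : ℕ, 1 ≤ l → 0 < q.eval (l : ℝ)) (hρ : 0 < ρ) :
    ContMDiff (𝓡 n) 𝓘(ℝ, ℝ) ∞ (wavelet n a c q ρ) := by
  rw [wavelet_eq]
  exact contMDiff_zonalSeries hn ((geometricDecay_waveletSeq a c hdeg hpos hρ).scaledCoeff n)

theorem exists_isPowerMesh_rpow_mul_eval (ha : 0 ≤ a) (hdeg : q.natDegree ≠ 0)
    (hpos : ∀ l : ℕ, 1 ≤ l → 0 < q.eval (l : ℝ)) :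
    ∃ k₁ k₂ k₃ : ℝ, 0 < k₁ ∧ 0 < k₂ ∧ 0 < k₃ ∧ ∀ ρ : ℝ, 0 < ρ → ρ ≤ 1 →
      IsPowerMesh k₁ k₂ k₃ q.natDegree (ρ ^ (a / q.natDegree))
        fun l => ρ ^ a * q.eval (l : ℝ) := by
  obtain ⟨k₁, hk₁, hlow⟩ := exists_mul_pow_le_eval hpos
  obtain ⟨k₂, hk₂, hupp⟩ := exists_abs_eval_le_mul_pow q le_rfl
  obtain ⟨k₃, hk₃, hincr⟩ := exists_abs_eval_sub_eval_succ_le q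
  refine ⟨k₁, k₂, k₃, hk₁, hk₂, hk₃, fun ρ hρ hρ1 => ?_⟩
  have hr : 0 < ρ ^ a := Real.rpow_pos_of_pos hρ a
  have hδ : (ρ ^ (a / (q.natDegree : ℝ))) ^ q.natDegree = ρ ^ a := by
    rw [← Real.rpow_natCast, ← Real.rpow_mul hρ.le, div_mul_cancel₀ _ (Nat.cast_ne_zero.mpr hdeg)]
  refine ⟨Real.rpow_pos_of_pos hρ _, Real.rpow_le_one hρ.le hρ1 (by positivity),
    fun l hl => ?_, fun l hl => ?_, fun l hl => ?_⟩
  · rw [mul_pow, hδ, mul_left_comm]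
    gcongr
    exact hlow l hl
  · rw [mul_pow, hδ, mul_left_comm]
    gcongr
    exact (le_abs_self _).trans (hupp l (by exact_mod_cast hl))
  · rw [mul_pow, ← mul_assoc (ρ ^ (a / (q.natDegree : ℝ))), mul_pow_sub_one hdeg, hδ, ← mul_sub,
      abs_mul, abs_of_pos hr, mul_left_comm]
    gcongr
    exact hincr l hl

theorem abs_profile_mul_le {r : ℝ} (hc : 0 ≤ c) (hr : 0 ≤ r) (hr1 : r ≤ 1) (y : ℝ) :
    |profile c (r * y)| ≤ |y| ^ c * Real.exp |y| := by
  have habs : |r * y| ≤ |y| := by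
    rw [abs_mul, abs_of_nonneg hr]
    exact mul_le_of_le_one_left (abs_nonneg _) hr1
  rw [profile, abs_mul, abs_of_pos (Real.exp_pos _)]
  gcongr
  · exact (Real.abs_rpow_le_abs_rpow _ _).trans (Real.rpow_le_rpow (abs_nonneg _) habs hc)
  · exact (neg_le_abs _).trans habs

theorem exists_isScaledSample_waveletSeq (ha : 0 ≤ a) (hc : 0 ≤ c) (hdeg : q.natDegree ≠ 0)
    (hpos : ∀ l : ℕ, 1 ≤ l → 0 < q.eval (l : ℝ)) (M : ℕ) :
    ∃ K : ℝ, 0 < K ∧ ∀ ρ : ℝ, 0 < ρ → ρ ≤ 1 →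
      IsScaledSample K (q.natDegree * c) M (ρ ^ (a / q.natDegree)) (waveletSeq a c q ρ) := by
  obtain ⟨k₁, k₂, k₃, hk₁, hk₂, hk₃, hmesh⟩ := exists_isPowerMesh_rpow_mul_eval ha hdeg hpos
  obtain ⟨K, hK, hsample⟩ := exists_isScaledSample_profile hc hk₁ hk₂ hk₃ hdeg M
    (|q.eval ((0 : ℕ) : ℝ)| ^ c * Real.exp |q.eval ((0 : ℕ) : ℝ)|)
  exact ⟨K, hK, fun ρ hρ hρ1 => hsample _ _ (hmesh ρ hρ hρ1)
    (abs_profile_mul_le hc (by positivity) (Real.rpow_le_one hρ.le hρ1 ha) _)⟩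

theorem tendsto_rpow_nhdsGT_zero {p : ℝ} (hp : 0 < p) :
    Tendsto (fun ρ : ℝ => ρ ^ p) (𝓝[>] 0) (𝓝 0) := by
  have h := (Real.continuousAt_rpow_const 0 p (Or.inr hp.le)).tendsto
  rw [Real.zero_rpow hp.ne'] at h
  exact h.mono_left nhdsWithin_le_nhds

theorem exists_eventually_variance_wavelet_bounds {n : ℕ} (hn : 2 ≤ n) (ha : 0 < a) (hc : 0 < c)
    (hdeg : q.natDegree ≠ 0) (hpos : ∀ l : ℕ, 1 ≤ l → 0 < q.eval (l : ℝ)) :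
    ∃ C : ℝ, 0 < C ∧ ∀ᶠ ρ : ℝ in 𝓝[>] 0, firstMoment (wavelet n a c q ρ) ≠ 0 ∧
      varS (wavelet n a c q ρ) ∈ Set.Icc 0 (C * ρ ^ (2 * a / q.natDegree)) ∧
      varM (wavelet n a c q ρ) ∈ Set.Icc 0 (C * ρ ^ (-(2 * a) / q.natDegree)) := by
  set ν := q.natDegree
  have : (0 : ℝ) < ν := by exact_mod_cast Nat.pos_of_ne_zero hdeg
  set M := n + 3 + ⌈ν * c⌉₊ with hM
  have hM_le : (n : ℝ) - 1 + 2 * (ν * c) ≤ 2 * M := by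
    have := Nat.le_ceil (ν * c)
    rw [hM]
    push_cast
    linarith [(Nat.cast_nonneg n : (0 : ℝ) ≤ n)]
  obtain ⟨K, hK, hsample⟩ := exists_isScaledSample_waveletSeq ha.le hc.le hdeg hpos M
  obtain ⟨C, hC, hbound⟩ := exists_variance_zonalSeries_bounds hn (by positivity : 0 < ν * c)
    hM_le (by omega) hK
  refine ⟨C, hC, ?_⟩
  have hsmall : ∀ᶠ ρ : ℝ in 𝓝[>] 0, C * ρ ^ (2 * a / ν) ≤ 1 := by
    have h := (tendsto_rpow_nhdsGT_zero (by positivity : 0 < 2 * a / ν)).const_mul C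
    rw [mul_zero] at h
    exact h.eventually_le_const one_pos
  filter_upwards [hsmall, Ioc_mem_nhdsGT one_pos] with ρ hρC ⟨hρ, hρ1⟩
  have hδ : (ρ ^ (a / ν)) ^ 2 = ρ ^ (2 * a / ν) := by
    rw [← Real.rpow_mul_natCast hρ.le]
    congr 1
    push_cast
    ring
  rw [neg_div, Real.rpow_neg hρ.le, ← div_eq_mul_inv, ← hδ, wavelet_eq]
  exact hbound _ _ (geometricDecay_waveletSeq a c hdeg hpos hρ) (hsample ρ hρ hρ1) (by rwa [hδ])

theorem isBigO_rpow_rpow_nhdsGT_zero {p r : ℝ} (h : r ≤ p) :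
    (fun ρ : ℝ => ρ ^ p) =O[𝓝[>] 0] fun ρ => ρ ^ r := by
  refine IsBigO.of_bound' ?_
  filter_upwards [Ioc_mem_nhdsGT one_pos] with ρ ⟨hρ, hρ1⟩
  rw [Real.norm_of_nonneg (by positivity), Real.norm_of_nonneg (by positivity)]
  exact Real.rpow_le_rpow_of_exponent_ge hρ hρ1 h

theorem isBigO_of_eventually_mem_Icc {α : Type*} {F : Filter α} {f g : α → ℝ} {C : ℝ}
    (h : ∀ᶠ x in F, f x ∈ Set.Icc 0 (C * g x)) : f =O[F] g := by
  refine IsBigO.of_bound |C| ?_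
  filter_upwards [h] with x ⟨h0, hle⟩
  rw [Real.norm_of_nonneg h0, Real.norm_eq_abs, ← abs_mul]
  exact hle.trans (le_abs_self _)

end Wavelet

end SphericalWavelet

end

theorem mainTheorem1_general {n : ℕ} (hn : 2 ≤ n) {a c : ℝ} (ha : 0 < a) (hc : 0 < c)
    {ν : ℕ} (hν : 1 ≤ ν) {q : Polynomial ℝ} (hdeg : q.natDegree = ν)
    (hpos : ∀ l : ℕ, 1 ≤ l → 0 < q.eval (l : ℝ)) :
    (∀ ρ : ℝ, 0 < ρ →
      (∀ x : SphericalWavelet.Sph n, Summable (SphericalWavelet.waveletTerm n a c q ρ x)) ∧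
      ContMDiff (𝓡 n) 𝓘(ℝ, ℝ) ∞ (SphericalWavelet.wavelet n a c q ρ)) ∧
    (∀ᶠ ρ : ℝ in 𝓝[>] 0,
      SphericalWavelet.firstMoment (SphericalWavelet.wavelet n a c q ρ) ≠ 0) ∧
    (fun ρ : ℝ => SphericalWavelet.varS (SphericalWavelet.wavelet n a c q ρ))
      =O[𝓝[>] 0] (fun ρ : ℝ => ρ ^ (2 * a / (ν : ℝ))) ∧
    (fun ρ : ℝ => SphericalWavelet.varM (SphericalWavelet.wavelet n a c q ρ))
      =O[𝓝[>] 0] (fun ρ : ℝ => ρ ^ (-(2 * a) / (ν : ℝ))) ∧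
    (fun ρ : ℝ => SphericalWavelet.uncertaintyProduct (SphericalWavelet.wavelet n a c q ρ))
      =O[𝓝[>] 0] (fun _ : ℝ => (1 : ℝ)) := by
  subst hdeg
  have hdeg : q.natDegree ≠ 0 := by omega
  obtain ⟨C, hC, hbound⟩ :=
    SphericalWavelet.exists_eventually_variance_wavelet_bounds hn ha hc hdeg hpos
  refine ⟨fun ρ hρ => ⟨SphericalWavelet.summable_waveletTerm hn a c hdeg hpos hρ,
      SphericalWavelet.contMDiff_wavelet hn a c hdeg hpos hρ⟩, hbound.mono fun ρ h => h.1,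
    SphericalWavelet.isBigO_of_eventually_mem_Icc (hbound.mono fun ρ h => h.2.1),
    SphericalWavelet.isBigO_of_eventually_mem_Icc (hbound.mono fun ρ h => h.2.2),
    SphericalWavelet.isBigO_of_eventually_mem_Icc (C := C) ?_⟩
  filter_upwards [hbound, self_mem_nhdsWithin] with ρ ⟨_, hS, hM⟩ (hρ : 0 < ρ)
  refine ⟨by rw [SphericalWavelet.uncertaintyProduct]; positivity, ?_⟩
  rw [SphericalWavelet.uncertaintyProduct, ← Real.sqrt_mul hS.1, mul_one]
  refine Real.sqrt_le_iff.mpr ⟨hC.le, (mul_le_mul hS.2 hM.2 hM.1 (by positivity)).trans_eq ?_⟩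
  rw [mul_mul_mul_comm, ← Real.rpow_add hρ, neg_div, add_neg_cancel, Real.rpow_zero, mul_one, sq]

theorem mainTheorem1 (n : ℕ) (hn : 2 ≤ n) (a c : ℝ) (ha : 0 < a) (hc : 0 < c)
    (ν : ℕ) (hν : 1 ≤ ν) (q : Polynomial ℝ) (hdeg : q.natDegree = ν)
    (hpos : ∀ l : ℕ, 1 ≤ l → 0 < q.eval (l : ℝ))
    (hmono : ∀ l m : ℕ, 1 ≤ l → l ≤ m → q.eval (l : ℝ) ≤ q.eval (m : ℝ)) :
    -- the wavelets are well defined, twice continuously differentiable functions on the sphere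
    (∀ ρ : ℝ, 0 < ρ →
      (∀ x : SphericalWavelet.Sph n, Summable (SphericalWavelet.waveletTerm n a c q ρ x)) ∧
      ContMDiff (𝓡 n) 𝓘(ℝ, ℝ) 2 (SphericalWavelet.wavelet n a c q ρ)) ∧
    -- the variances are defined for all small scales
    (∀ᶠ ρ : ℝ in 𝓝[>] 0,
      SphericalWavelet.firstMoment (SphericalWavelet.wavelet n a c q ρ) ≠ 0) ∧
    (fun ρ : ℝ => SphericalWavelet.varS (SphericalWavelet.wavelet n a c q ρ))
      =O[𝓝[>] 0] (fun ρ : ℝ => ρ ^ (a / (ν : ℝ))) ∧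
    (fun ρ : ℝ => SphericalWavelet.varM (SphericalWavelet.wavelet n a c q ρ))
      =O[𝓝[>] 0] (fun ρ : ℝ => ρ ^ (-(2 * a) / (ν : ℝ))) ∧
    (fun ρ : ℝ => SphericalWavelet.uncertaintyProduct (SphericalWavelet.wavelet n a c q ρ))
      =O[𝓝[>] 0] (fun ρ : ℝ => ρ ^ (-a / (2 * (ν : ℝ)))) := by
  obtain ⟨hwell, hmoment, hS, hM, hU⟩ := mainTheorem1_general hn ha hc hν hdeg hpos
  refine ⟨fun ρ hρ => ⟨(hwell ρ hρ).1, (hwell ρ hρ).2.of_le ENat.LEInfty.out⟩, hmoment,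
    hS.trans (SphericalWavelet.isBigO_rpow_rpow_nhdsGT_zero ?_), hM, hU.trans ?_⟩
  · gcongr
    linarith
  · simpa only [Real.rpow_zero] using SphericalWavelet.isBigO_rpow_rpow_nhdsGT_zero
      (div_nonpos_of_nonpos_of_nonneg (neg_nonpos.mpr ha.le) (by positivity : 0 ≤ 2 * (ν : ℝ)))
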